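/- Let $q(i,j;n)$ be the number of walks of length $n$ with steps N, S, E, W, NE, SW, that is, with steps in $\{(0,1),(0,-1),(1,0),(-1,0),(1,1),(-1,-1)\}$, that start at $(0,0)$, end at $(i,j)$ and stay in the quarter plane $\{(a,b): a\ge 0,\ b\ge 0\}$. Let $$Q(x,y;t)=\sum_{n,i,j\ge 0} q(i,j;n)\,x^iy^jt^n\in\mathbb{Q}[x,y][[t]],\qquad Q_d(x;t)=\sum_{n,i\ge 0} q(i,i;n)\,x^it^n .$$ There is a unique power series $Z\equiv Z(t)\in\mathbb{Q}[[t]]$ with no constant term such that $$Z=t\,\frac{1-2Z+6Z^2-2Z^3+Z^4}{(1-Z)^2}.$$ Let $$\Delta_+(x)=1-2Z\,\frac{1+Z^2}{(1-Z)^2}\,x+Z^2x^2 ,$$ and let $\sqrt{\Delta_+(x)}$ be its unique square root in $\mathbb{Q}[x][[t]]$ whose constant term in $t$ is $1$. Then $$Q(0,0;t)=\frac{Z\,(1-2Z-Z^2)}{t\,(1-Z)^2},$$ the generating function of walks ending on the $x$-axis is $$Q(x,0;t)=\frac{\left(Z(1-Z)+2xZ-(1-Z)x^2\right)\sqrt{\Delta_+(x)}}{2txZ(1-Z)(1+x)^2}-\frac{Z(1-Z)^2+Z\left(Z^3+4Z^2-5Z+2\right)x-\left(1-2Z+7Z^2-4Z^3\right)x^2+x^3Z(1-Z)^2}{2txZ(1-Z)^2(1+x)^2},$$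 and the generating function of walks ending on the diagonal is $$Q_d(x;t)=\frac{1-Z-2xZ+x^2Z(Z-1)}{tx(1+x)(Z-1)\sqrt{\Delta_+(x)}}+\frac{1}{tx(1+x)} .$$ Consequently, $Q(x,y;t)$ is algebraic: it satisfies a non-trivial polynomial equation with coefficients in $\mathbb{Q}[x,y,t]$. -/

import Mathlib

noncomputable section

namespace QuadrantWalks

/-- The list `w` of steps is a walk of length `n` with steps in `S` that starts at the origin, stays
in the quarter plane (every initial segment ends in it), and ends at `(i, j)`. -/
def IsQuadrantWalk (S : Finset (ℤ × ℤ)) (i j n : ℕ) (w : List (ℤ × ℤ)) : Prop :=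
  w.length = n ∧ (∀ s ∈ w, s ∈ S) ∧
    (∀ p : List (ℤ × ℤ), p <+: w → 0 ≤ p.sum.1 ∧ 0 ≤ p.sum.2) ∧
    w.sum = ((i : ℤ), (j : ℤ))

/-- The number of walks of length `n` in the quarter plane with steps in `S`, from the origin to
`(i, j)`. -/
def walkCount (S : Finset (ℤ × ℤ)) (i j n : ℕ) : ℕ :=
  {w : List (ℤ × ℤ) | IsQuadrantWalk S i j n w}.ncard

/-- There are finitely many such walks, so that `walkCount` really counts them. -/
theorem finite_quadrantWalks (S : Finset (ℤ × ℤ)) (i j n : ℕ) :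
    {w : List (ℤ × ℤ) | IsQuadrantWalk S i j n w}.Finite := by
  refine ((List.finite_length_eq S n).image (List.map Subtype.val)).subset ?_
  rintro w ⟨hl, hS, -, -⟩
  refine ⟨w.attach.map fun s => ⟨s.1, hS s.1 s.2⟩, ?_, ?_⟩
  · simpa using hl
  · rw [List.map_map]
    exact List.attach_map_subtype_val w

/-- The steps N, S, E, W, NE, SW. -/
def steps : Finset (ℤ × ℤ) := {(0, 1), (0, -1), (1, 0), (-1, 0), (1, 1), (-1, -1)}

/-- The number of walks with steps N, S, E, W, NE, SW of length `n` ending at `(i, j)`. -/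
def q (i j n : ℕ) : ℕ := walkCount steps i j n

theorem sum_le_length (w : List (ℤ × ℤ)) (hS : ∀ s ∈ w, s ∈ steps) :
    w.sum.1 ≤ w.length ∧ w.sum.2 ≤ w.length := by
  induction w with
  | nil => simp
  | cons a w ih =>
    have h1 := ih fun s hs => hS s (List.mem_cons_of_mem _ hs)
    have h2 : a.1 ≤ 1 ∧ a.2 ≤ 1 := by
      have := hS a List.mem_cons_self
      simp only [steps, Finset.mem_insert, Finset.mem_singleton] at this
      rcases this with h | h | h | h | h | h <;> subst h <;> simp
    simp only [List.sum_cons, Prod.fst_add, Prod.snd_add, List.length_cons, Nat.cast_add,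
      Nat.cast_one]
    omega

/-- A walk of length `n` ends in `{0, …, n} × {0, …, n}`. -/
theorem q_eq_zero {i j n : ℕ} (h : n < i ∨ n < j) : q i j n = 0 := by
  unfold q walkCount
  rw [Set.ncard_eq_zero (finite_quadrantWalks _ _ _ _), Set.eq_empty_iff_forall_notMem]
  rintro w ⟨hl, hS, -, he⟩
  have := sum_le_length w hS
  rw [he, hl] at this
  simp only [Nat.cast_le] at this
  omega

open Polynomial

/-- The generating function `Q(x,y;t) = ∑ q(i,j;n) x^i y^j t^n`, a power series in `t` whose
coefficients lie in `ℚ[x][y]`. -/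
def Q : PowerSeries ℚ[X][X] :=
  PowerSeries.mk fun n =>
    ∑ i ∈ Finset.range (n + 1), ∑ j ∈ Finset.range (n + 1), monomial j (monomial i (q i j n : ℚ))

/-- The coefficient of `x^i y^j t^n` in `Q(x,y;t)` is `q(i,j;n)`, for all `i`, `j`, `n`. -/
theorem coeff_Q (i j n : ℕ) : ((PowerSeries.coeff n Q).coeff j).coeff i = (q i j n : ℚ) := by
  simp only [Q, PowerSeries.coeff_mk, Polynomial.finsetSum_coeff, Polynomial.coeff_monomial]
  rw [Finset.sum_comm]
  by_cases hj : j ∈ Finset.range (n + 1)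
  · by_cases hi : i ∈ Finset.range (n + 1)
    · simp only [apply_ite (fun p : ℚ[X] => p.coeff i), Polynomial.coeff_monomial,
        Polynomial.coeff_zero]
      rw [Finset.sum_eq_single j, Finset.sum_eq_single i] <;> simp_all
    · rw [q_eq_zero (Or.inl (by simpa using hi))]
      simp only [apply_ite (fun p : ℚ[X] => p.coeff i), Polynomial.coeff_monomial,
        Polynomial.coeff_zero]
      refine (Finset.sum_eq_zero fun b _ => Finset.sum_eq_zero fun a ha => ?_).trans (by simp)
      have : a ≠ i := fun h => hi (h ▸ ha)
      simp [this]
  · rw [q_eq_zero (Or.inr (by simpa using hj))]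
    simp only [apply_ite (fun p : ℚ[X] => p.coeff i), Polynomial.coeff_monomial,
      Polynomial.coeff_zero]
    refine (Finset.sum_eq_zero fun b hb => Finset.sum_eq_zero fun a _ => ?_).trans (by simp)
    have : b ≠ j := fun h => hj (h ▸ hb)
    simp [this]

/-- `Q(x,0;t)`: the specialization `y = 0` of `Q(x,y;t)`. -/
def Qx0 : PowerSeries ℚ[X] := PowerSeries.map (evalRingHom (0 : ℚ[X])) Q

/-- `Q(0,0;t)`: the specialization `x = 0` of `Q(x,0;t)`. -/
def Q00 : PowerSeries ℚ := PowerSeries.map (evalRingHom (0 : ℚ)) Qx0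

/-- `Q_d(x;t) = ∑ q(i,i;n) x^i t^n`, the generating function of walks ending on the diagonal. -/
def Qd : PowerSeries ℚ[X] :=
  PowerSeries.mk fun n => ∑ i ∈ Finset.range (n + 1), monomial i (q i i n : ℚ)

theorem coeff_Qx0 (i n : ℕ) : (PowerSeries.coeff n Qx0).coeff i = (q i 0 n : ℚ) := by
  rw [← coeff_Q, Qx0, PowerSeries.coeff_map, coe_evalRingHom, ← coeff_zero_eq_eval_zero]

theorem coeff_Q00 (n : ℕ) : PowerSeries.coeff n Q00 = (q 0 0 n : ℚ) := by
  rw [← coeff_Qx0, Q00, PowerSeries.coeff_map, coe_evalRingHom, ← coeff_zero_eq_eval_zero]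

theorem coeff_Qd (i n : ℕ) : (PowerSeries.coeff n Qd).coeff i = (q i i n : ℚ) := by
  simp only [Qd, PowerSeries.coeff_mk, Polynomial.finsetSum_coeff, Polynomial.coeff_monomial]
  rw [Finset.sum_ite_eq']
  split_ifs with h
  · rfl
  · rw [q_eq_zero (Or.inl (by simpa using h)), Nat.cast_zero]

/-- `Z` is a power series in `t` without constant term such that
`Z = t (1 - 2Z + 6Z² - 2Z³ + Z⁴) / (1 - Z)²`. (Since `(1 - Z)²` has constant term `1`, the `⁻¹`
below is its inverse in `ℚ[[t]]`.) -/
def IsZ (Z : PowerSeries ℚ) : Prop :=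
  PowerSeries.constantCoeff Z = 0 ∧
    Z = PowerSeries.X * (1 - 2 * Z + 6 * Z ^ 2 - 2 * Z ^ 3 + Z ^ 4) * ((1 - Z) ^ 2)⁻¹

/-- The field of fractions of `ℚ[x][[t]]`, in which the explicit expressions are written. -/
abbrev F : Type := FractionRing (PowerSeries ℚ[X])

/-- The inclusion of `ℚ[x][[t]]` in its field of fractions. -/
def toF : PowerSeries ℚ[X] →+* F := algebraMap (PowerSeries ℚ[X]) F

/-- The inclusion of `ℚ[[t]]` in the field of fractions of `ℚ[x][[t]]`. -/
def constToF : PowerSeries ℚ →+* F := toF.comp (PowerSeries.map (C : ℚ →+* ℚ[X]))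

/-- The variable `x`, as an element of the field `F`. -/
def x : F := toF (PowerSeries.C (X : ℚ[X]))

/-- The variable `t`, as an element of the field `F`. -/
def t : F := toF PowerSeries.X

/-- `Δ₊(x) = 1 - 2 Z (1 + Z²) / (1 - Z)² x + Z² x²`. -/
def deltaPlus (Z : F) : F := 1 - 2 * Z * ((1 + Z ^ 2) / (1 - Z) ^ 2) * x + Z ^ 2 * x ^ 2

/-- `R ∈ ℚ[x][[t]]` is the square root of `Δ₊(x)` with constant term `1` in `t`. -/
def IsSqrtDeltaPlus (Z : F) (R : PowerSeries ℚ[X]) : Prop :=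
  PowerSeries.constantCoeff R = 1 ∧ toF R ^ 2 = deltaPlus Z

/-- Algebraicity of `Q(x,y;t)` over `ℚ[x][y][t]` refers to the usual inclusion of polynomials in `t`
with coefficients in `ℚ[x][y]` in the power series in `t` with these coefficients. -/
theorem smul_eq_coe_mul (P : ℚ[X][X][X]) (G : PowerSeries ℚ[X][X]) :
    P • G = (P : PowerSeries ℚ[X][X]) * G := by
  rw [Algebra.smul_def, PowerSeries.algebraMap_apply']
  simp

end QuadrantWalks

end

open QuadrantWalks

noncomputable section

/-! The proof is a kernel method with invariants. Write A(x) = Q(x,0), q = Q(0,0) and S =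
`sqrtFactor`. Removing the last step of a walk, together with the symmetry in x and y, gives
`functional_equation`. The kernel has a root y in ℚ(x)⟦t⟧ without constant term
(`exists_kernel_root`), and substituting it gives t(1+x)A(x) + t(1+y)A(y) - tq = xy.

Two facts separate the variables. On the kernel curve 2xy = F(x) + F(y) with F(x) = x/(t(1+x)) -
(1+2x+x³)/(x(1+x)). Moreover N(x) = S(x)√Δ₊(x)/(x(1+x)) satisfies N(x) + N(y) = 0
(`sqrtFactor_antiinvariant`). Hence 2t(1+x)A(x) - tq - F(x) - cN(x) changes sign under x ↔ y for
every c free of x. The choice c = 1/(Z(1-Z)) cancels the pole at x = 0, and an antisymmetric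
expression without that pole vanishes (`eq_zero_of_antisymmetric`). This gives `Qx0_formula`, and x
= 0 gives `Q00_formula`. The series Z enters because the discriminant of the kernel in y is (t/Z)²
x² Δ₊(x)Δ₊(1/x).

For the diagonal, walks ending weakly below it satisfy `lower_functional_equation`, whose kernel has
the root v = xy. There Q_d(x) is expressed by A(v), which is known; `diagFactor_eq` turns √Δ₊(v)
into a rational multiple of 1/√Δ₊(x), and v drops out.

Algebraicity follows: Z is algebraic over ℚ[t], hence so are √Δ₊, q, A(x) and A(y) over ℚ[x,y,t],
and `functional_equation` can be divided by the kernel. -/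

namespace QuadrantWalks

/-! ### Fixed points and substitution in power series. -/

section PowerSeriesTools

open PowerSeries

variable {R S B : Type*} [CommRing R] [CommRing S] [CommRing B]

/-- A map on `R⟦X⟧` that is contracting for the `X`-adic metric has a unique fixed point. -/
theorem existsUnique_fixedPoint (T : PowerSeries R → PowerSeries R)
    (hT : ∀ f g, X * (f - g) ∣ T f - T g) : ∃! f, T f = f := by
  have step : ∀ n f g, X ^ n ∣ f - g → X ^ (n + 1) ∣ T f - T g := by
    intro n f g h
    refine dvd_trans ?_ (hT f g)
    rw [pow_succ']
    exact mul_dvd_mul_left _ h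
  have ext_dvd : ∀ f : PowerSeries R, (∀ n, X ^ n ∣ f) → f = 0 := by
    intro f h
    ext n
    exact X_pow_dvd_iff.1 (h (n + 1)) n n.lt_succ_self
  let a : ℕ → PowerSeries R := fun n => T^[n] 0
  have ha : ∀ n, a (n + 1) = T (a n) := fun n => Function.iterate_succ_apply' T n 0
  have h1 : ∀ n, X ^ n ∣ a (n + 1) - a n := by
    intro n
    induction n with
    | zero => simp
    | succ n ih => rw [ha (n + 1), ha n]; rw [ha n] at ih; exact step n _ _ ih
  have h2 : ∀ n m, X ^ n ∣ a (n + m) - a n := by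
    intro n m
    induction m with
    | zero => simp
    | succ m ih =>
      have := dvd_add ((pow_dvd_pow X (Nat.le_add_right n m)).trans (h1 (n + m))) ih
      simpa [add_assoc] using this
  -- The coefficient of index n is constant along the iterates from the (n+1)-st on, so this is
  -- their limit.
  let f : PowerSeries R := mk fun n => coeff n (a (n + 1))
  have h3 : ∀ n, X ^ n ∣ f - a n := by
    intro n
    rw [X_pow_dvd_iff]
    intro m hm
    obtain ⟨k, rfl⟩ := Nat.exists_eq_add_of_lt hm
    have := X_pow_dvd_iff.1 (h2 (m + 1) k) m m.lt_succ_self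
    rw [map_sub, sub_eq_zero] at this ⊢
    rw [coeff_mk, ← this]
    congr 2
    omega
  refine ⟨f, ?_, ?_⟩
  · change T f = f
    rw [← sub_eq_zero]
    refine ext_dvd _ fun n => ?_
    have e1 := step n _ _ (h3 n)
    have e2 := h3 (n + 1)
    rw [← ha] at e1
    have := dvd_sub e1 e2
    rw [sub_sub_sub_cancel_right] at this
    exact (pow_dvd_pow X n.le_succ).trans this
  · intro g hg
    rw [← sub_eq_zero]
    refine ext_dvd _ fun n => ?_
    induction n with
    | zero => simp
    | succ n ih =>
      have e1 := step n _ _ ih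
      have e2 := step n _ _ (h3 n)
      rw [← ha] at e2
      have e3 := h3 (n + 1)
      have := dvd_add e1 (dvd_sub e2 e3)
      rw [hg] at this
      have e : g - T f + (T f - a (n + 1) - (f - a (n + 1))) = g - f := by ring
      rwa [e] at this

/-- The value of `∑ bₙ Xⁿ` when the coefficients are mapped to power series by `φ`. -/
def evalSeriesFun (φ : B →+* PowerSeries S) (f : PowerSeries B) : PowerSeries S :=
  mk fun n => ∑ p ∈ Finset.HasAntidiagonal.antidiagonal n, coeff p.2 (φ (coeff p.1 f))

variable (φ : B →+* PowerSeries S)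

theorem evalSeriesFun_add (f g : PowerSeries B) :
    evalSeriesFun φ (f + g) = evalSeriesFun φ f + evalSeriesFun φ g := by
  ext n
  simp [evalSeriesFun, Finset.sum_add_distrib]

theorem evalSeriesFun_coe_monomial (k : ℕ) (b : B) :
    evalSeriesFun φ ((Polynomial.monomial k b : Polynomial B) : PowerSeries B) = φ b * X ^ k := by
  ext n
  rw [coeff_mul_X_pow', evalSeriesFun, coeff_mk]
  split_ifs with h
  · rw [Finset.sum_eq_single (k, n - k)]
    · simp
    · rintro ⟨i, j⟩ hij hne
      have : k ≠ i := by
        rintro rfl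
        apply hne
        rw [Finset.HasAntidiagonal.mem_antidiagonal] at hij
        simp only [Prod.mk.injEq, true_and]
        omega
      simp [coeff_monomial, this.symm]
    · intro hn
      exact (hn (by simp only [Finset.HasAntidiagonal.mem_antidiagonal]; omega)).elim
  · refine Finset.sum_eq_zero ?_
    rintro ⟨i, j⟩ hij
    have : k ≠ i := by
      rintro rfl
      rw [Finset.HasAntidiagonal.mem_antidiagonal] at hij
      omega
    simp [coeff_monomial, this.symm]

theorem evalSeriesFun_coe (p : Polynomial B) :
    evalSeriesFun φ (p : PowerSeries B) = p.eval₂ φ X := by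
  induction p using Polynomial.induction_on' with
  | add p q hp hq => rw [Polynomial.coe_add, evalSeriesFun_add, hp, hq, Polynomial.eval₂_add]
  | monomial n b => rw [evalSeriesFun_coe_monomial, Polynomial.eval₂_monomial]

theorem coeff_evalSeriesFun_congr {f g : PowerSeries B} {n : ℕ}
    (h : ∀ m ≤ n, coeff m f = coeff m g) :
    ∀ m ≤ n, coeff m (evalSeriesFun φ f) = coeff m (evalSeriesFun φ g) := by
  intro m hm
  rw [evalSeriesFun, evalSeriesFun, coeff_mk, coeff_mk]
  refine Finset.sum_congr rfl ?_
  rintro ⟨i, j⟩ hij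
  rw [Finset.HasAntidiagonal.mem_antidiagonal] at hij
  simp only at hij ⊢
  rw [h i (by omega)]

theorem coeff_mul_congr {f f' g g' : PowerSeries S} {n : ℕ}
    (h : ∀ m ≤ n, coeff m f = coeff m f') (h' : ∀ m ≤ n, coeff m g = coeff m g') :
    ∀ m ≤ n, coeff m (f * g) = coeff m (f' * g') := by
  intro m hm
  rw [coeff_mul, coeff_mul]
  refine Finset.sum_congr rfl ?_
  rintro ⟨i, j⟩ hij
  rw [Finset.HasAntidiagonal.mem_antidiagonal] at hij
  simp only at hij ⊢
  rw [h i (by omega), h' j (by omega)]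

/-- The coefficients up to n of either side depend only on those of `f` and `g` up to n. So both
series may be truncated to polynomials, where the map is `eval₂`, a ring homomorphism. -/
theorem evalSeriesFun_mul (f g : PowerSeries B) :
    evalSeriesFun φ (f * g) = evalSeriesFun φ f * evalSeriesFun φ g := by
  ext n
  have ht : ∀ h : PowerSeries B, ∀ m ≤ n,
      coeff m h = coeff m ((trunc (n + 1) h : Polynomial B) : PowerSeries B) := by
    intro h m hm
    rw [Polynomial.coeff_coe, coeff_trunc, if_pos (by omega)]
  rw [coeff_evalSeriesFun_congr φ (coeff_mul_congr (ht f) (ht g)) n le_rfl,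
    coeff_mul_congr (coeff_evalSeriesFun_congr φ (ht f)) (coeff_evalSeriesFun_congr φ (ht g)) n
      le_rfl, ← Polynomial.coe_mul, evalSeriesFun_coe, evalSeriesFun_coe, evalSeriesFun_coe,
    Polynomial.eval₂_mul]

/-- The ring homomorphism `B⟦X⟧ → S⟦X⟧` that extends `φ : B → S⟦X⟧`, fixes `X` and is continuous. -/
def evalSeries : PowerSeries B →+* PowerSeries S where
  toFun := evalSeriesFun φ
  map_one' := by
    have := evalSeriesFun_coe φ 1
    simpa using this
  map_zero' := by
    have := evalSeriesFun_coe φ 0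
    simpa using this
  map_add' := evalSeriesFun_add φ
  map_mul' := evalSeriesFun_mul φ

theorem evalSeries_apply (f : PowerSeries B) : evalSeries φ f = evalSeriesFun φ f := rfl

@[simp]
theorem evalSeries_C (b : B) : evalSeries φ (C b) = φ b := by
  have := evalSeriesFun_coe φ (Polynomial.C b)
  simpa [evalSeries_apply] using this

@[simp]
theorem evalSeries_X : evalSeries φ X = X := by
  have := evalSeriesFun_coe φ Polynomial.X
  simpa [evalSeries_apply] using this

theorem constantCoeff_evalSeries (f : PowerSeries B) :
    constantCoeff (evalSeries φ f) = constantCoeff (φ (constantCoeff f)) := by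
  rw [evalSeries_apply, ← coeff_zero_eq_constantCoeff_apply]
  simp [evalSeriesFun]

theorem evalSeries_map {B' : Type*} [CommRing B'] (ψ : B' →+* B) (f : PowerSeries B') :
    evalSeries φ (map ψ f) = evalSeries (φ.comp ψ) f := by
  change evalSeriesFun φ _ = evalSeriesFun _ f
  ext n
  simp [evalSeriesFun]

theorem map_eq_evalSeries (ψ : B →+* S) (f : PowerSeries B) :
    map ψ f = evalSeries (C.comp ψ) f := by
  change _ = evalSeriesFun _ f
  ext n
  rw [evalSeriesFun, coeff_mk, Finset.sum_eq_single (n, 0)]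
  · simp
  · rintro ⟨i, j⟩ hij hne
    rw [Finset.HasAntidiagonal.mem_antidiagonal] at hij
    have : j ≠ 0 := by
      rintro rfl
      simp at hij
      simp [hij] at hne
    simp [coeff_C, this]
  · simp

theorem exists_eq_X_pow_mul {f : PowerSeries R} (hf : f ≠ 0) :
    ∃ n g, f = X ^ n * g ∧ constantCoeff g ≠ 0 := by
  obtain ⟨g, hg⟩ := X_pow_order_dvd (φ := f)
  refine ⟨_, g, hg, fun h0 => coeff_order hf ?_⟩
  have := congrArg (coeff f.order.toNat) hg
  rw [this, coeff_X_pow_mul', if_pos le_rfl, Nat.sub_self]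
  simpa using h0

end PowerSeriesTools

/-! ### The last-step recurrence for quadrant walks and its symmetry. -/

section Walks

/-- The walks of length `n` from the origin to `(a, b)` in the quarter plane, as a set. -/
def walkSet (a b : ℤ) (n : ℕ) : Set (List (ℤ × ℤ)) :=
  {w | w.length = n ∧ (∀ s ∈ w, s ∈ steps) ∧
    (∀ p : List (ℤ × ℤ), p <+: w → 0 ≤ p.sum.1 ∧ 0 ≤ p.sum.2) ∧ w.sum = (a, b)}

theorem walkSet_finite (a b : ℤ) (n : ℕ) : (walkSet a b n).Finite := by
  refine ((List.finite_length_eq steps n).image (List.map Subtype.val)).subset ?_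
  rintro w ⟨hl, hS, -, -⟩
  refine ⟨w.attach.map fun s => ⟨s.1, hS s.1 s.2⟩, ?_, ?_⟩
  · simpa using hl
  · rw [List.map_map]
    exact List.attach_map_subtype_val w

theorem walkSet_eq_empty {a b : ℤ} (h : a < 0 ∨ b < 0) (n : ℕ) : walkSet a b n = ∅ := by
  rw [Set.eq_empty_iff_forall_notMem]
  rintro w ⟨-, -, hp, he⟩
  have := hp w (List.prefix_refl w)
  rw [he] at this
  simp only at this
  omega

theorem walkSet_zero (a b : ℤ) : walkSet a b 0 = if a = 0 ∧ b = 0 then {[]} else ∅ := by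
  ext w
  constructor
  · rintro ⟨hl, -, -, he⟩
    rw [List.length_eq_zero_iff] at hl
    subst hl
    have : a = 0 ∧ b = 0 := by
      simpa [eq_comm, Prod.ext_iff] using he
    simp [this]
  · split_ifs with h
    · rintro rfl
      obtain ⟨rfl, rfl⟩ := h
      refine ⟨rfl, by simp, ?_, rfl⟩
      intro p hp
      rw [List.prefix_nil] at hp
      simp [hp]
    · simp

/-- The only initial segment of `w ++ [s]` that is not one of `w` is the whole list. It ends at (a,
b), which `ha` and `hb` place in the quadrant. -/
theorem append_mem_walkSet {a b : ℤ} (ha : 0 ≤ a) (hb : 0 ≤ b) (n : ℕ) (w : List (ℤ × ℤ))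
    (s : ℤ × ℤ) :
    w ++ [s] ∈ walkSet a b (n + 1) ↔ s ∈ steps ∧ w ∈ walkSet (a - s.1) (b - s.2) n := by
  simp only [walkSet, Set.mem_ofPred_eq, List.length_append, List.length_singleton,
    List.mem_append, List.mem_singleton, List.prefix_concat_iff, List.sum_append, List.sum_singleton]
  constructor
  · rintro ⟨h1, h2, h3, h4⟩
    refine ⟨h2 s (Or.inr rfl), by omega, fun r hr => h2 r (Or.inl hr), fun p hp => h3 p (Or.inr hp),
      ?_⟩
    rw [← eq_sub_iff_add_eq] at h4
    exact h4
  · rintro ⟨h0, h1, h2, h3, h4⟩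
    have h5 : w.sum + s = (a, b) := by
      rw [h4, Prod.ext_iff]
      simp
    refine ⟨by omega, ?_, ?_, h5⟩
    · rintro r (hr | rfl)
      exacts [h2 r hr, h0]
    · rintro p (rfl | hp)
      · rw [List.sum_append, List.sum_singleton, h5]
        exact ⟨ha, hb⟩
      · exact h3 p hp

theorem ncard_walkSet_succ {a b : ℤ} (ha : 0 ≤ a) (hb : 0 ≤ b) (n : ℕ) :
    (walkSet a b (n + 1)).ncard = ∑ s ∈ steps, (walkSet (a - s.1) (b - s.2) n).ncard := by
  classical
  let fs := fun (a b : ℤ) (n : ℕ) => (walkSet_finite a b n).toFinset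
  have hfs : ∀ a b n, (walkSet a b n).ncard = (fs a b n).card := fun a b n =>
    Set.ncard_eq_toFinset_card _ (walkSet_finite a b n)
  have key : fs a b (n + 1) =
      steps.biUnion fun s => (fs (a - s.1) (b - s.2) n).image (· ++ [s]) := by
    ext w
    simp only [fs, Set.Finite.mem_toFinset, Finset.mem_biUnion, Finset.mem_image]
    constructor
    · intro hw
      rcases List.eq_nil_or_concat' w with rfl | ⟨v, s, rfl⟩
      · simp [walkSet] at hw
      · rw [append_mem_walkSet ha hb] at hw
        exact ⟨s, hw.1, v, hw.2, rfl⟩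
    · rintro ⟨s, hs, v, hv, rfl⟩
      exact (append_mem_walkSet ha hb n v s).2 ⟨hs, hv⟩
  rw [hfs, key, Finset.card_biUnion]
  · refine Finset.sum_congr rfl fun s _ => ?_
    rw [hfs, Finset.card_image_of_injective]
    intro v w h
    exact List.append_cancel_right h
  · intro s _ r _ hsr
    rw [Function.onFun, Finset.disjoint_left]
    intro w h1 h2
    rw [Finset.mem_image] at h1 h2
    obtain ⟨v1, -, rfl⟩ := h1
    obtain ⟨v2, -, h⟩ := h2
    have := (List.append_inj' h rfl).2
    simp only [List.cons.injEq, and_true] at this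
    exact hsr this.symm

/-- The number of walks of length `n` ending at `(a, b)`, extended by `0` to all integers. -/
def walkNum (a b n : ℤ) : ℚ := if 0 ≤ n then ((walkSet a b n.toNat).ncard : ℚ) else 0

theorem walkNum_natCast (i j n : ℕ) : walkNum i j n = q i j n := by
  simp only [walkNum, Int.natCast_nonneg, if_true, Int.toNat_natCast]
  rfl

theorem walkNum_of_neg {a b n : ℤ} (h : a < 0 ∨ b < 0 ∨ n < 0) : walkNum a b n = 0 := by
  rw [walkNum]
  split_ifs with hn
  · rw [walkSet_eq_empty (by omega)]
    simp
  · rfl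

/-- Since the count is zero outside the quadrant and for negative lengths, one formula covers
boundary points and the empty walk. -/
theorem walkNum_rec {a b : ℤ} (ha : 0 ≤ a) (hb : 0 ≤ b) (n : ℤ) :
    walkNum a b n = (if a = 0 ∧ b = 0 ∧ n = 0 then 1 else 0) + walkNum a (b - 1) (n - 1) +
      walkNum a (b + 1) (n - 1) + walkNum (a - 1) b (n - 1) + walkNum (a + 1) b (n - 1) +
      walkNum (a - 1) (b - 1) (n - 1) + walkNum (a + 1) (b + 1) (n - 1) := by
  rcases lt_trichotomy n 0 with hn | rfl | hn
  · have : n - 1 < 0 := by omega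
    simp [walkNum_of_neg, hn, this, hn.ne]
  · simp only [walkNum_of_neg (n := (0 : ℤ) - 1) (Or.inr (Or.inr (by norm_num)))]
    simp only [walkNum, le_refl, if_true, Int.toNat_zero, walkSet_zero]
    split_ifs with h1 h2 h2 <;> simp_all
  · obtain ⟨m, rfl⟩ : ∃ m : ℕ, n = m + 1 := ⟨(n - 1).toNat, by omega⟩
    have e : ((m : ℤ) + 1).toNat = m + 1 := by omega
    have e' : (m : ℤ) + 1 ≠ 0 := by omega
    simp only [walkNum, add_sub_cancel_right, Int.natCast_nonneg, if_true, Int.toNat_natCast,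
      if_pos hn.le, e, ncard_walkSet_succ ha hb, e', and_false, if_false, steps]
    rw [Finset.sum_insert (by decide), Finset.sum_insert (by decide), Finset.sum_insert (by decide),
      Finset.sum_insert (by decide), Finset.sum_insert (by decide), Finset.sum_singleton]
    simp only [sub_zero, sub_neg_eq_add]
    push_cast
    ring

/-- The step set is stable under exchanging coordinates, so the recurrence is too, and induction on
the length applies. -/
theorem walkNum_symm (a b n : ℤ) : walkNum a b n = walkNum b a n := by
  rcases lt_or_ge n 0 with hn | hn
  · rw [walkNum_of_neg (by omega), walkNum_of_neg (by omega)]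
  lift n to ℕ using hn
  induction n generalizing a b with
  | zero =>
    by_cases h : 0 ≤ a ∧ 0 ≤ b
    · rw [walkNum_rec h.1 h.2, walkNum_rec h.2 h.1]
      simp only [walkNum_of_neg (n := ((0 : ℕ) : ℤ) - 1) (Or.inr (Or.inr (by norm_num)))]
      simp only [← and_assoc, and_comm]
    · rw [walkNum_of_neg (by omega), walkNum_of_neg (by omega)]
  | succ n ih =>
    by_cases h : 0 ≤ a ∧ 0 ≤ b
    · rw [walkNum_rec h.1 h.2, walkNum_rec h.2 h.1]
      have e : ((n + 1 : ℕ) : ℤ) - 1 = n := by push_cast; ring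
      have e' : ((n + 1 : ℕ) : ℤ) ≠ 0 := by omega
      simp only [e, e', and_false, if_false]
      rw [ih a (b - 1), ih a (b + 1), ih (a - 1), ih (a + 1) b, ih (a - 1), ih (a + 1)]
      ring
    · rw [walkNum_of_neg (by omega), walkNum_of_neg (by omega)]

end Walks

open Polynomial

/-! ### Functional equations for all walks and for walks ending below the diagonal. -/

section FunctionalEquations

/-- The coefficient of `x^i y^j t^n`, extended by `0` to all integers. -/
def intCoeff (f : PowerSeries ℚ[X][X]) (i j n : ℤ) : ℚ :=
  if 0 ≤ i ∧ 0 ≤ j ∧ 0 ≤ n then ((PowerSeries.coeff n.toNat f).coeff j.toNat).coeff i.toNat else 0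

theorem intCoeff_natCast (f : PowerSeries ℚ[X][X]) (i j n : ℕ) :
    intCoeff f i j n = ((PowerSeries.coeff n f).coeff j).coeff i := by
  simp [intCoeff]

theorem eq_of_intCoeff {f g : PowerSeries ℚ[X][X]}
    (h : ∀ i j n, intCoeff f i j n = intCoeff g i j n) : f = g := by
  ext n j i
  rw [← intCoeff_natCast, h, intCoeff_natCast]

theorem intCoeff_add (f g : PowerSeries ℚ[X][X]) (i j n : ℤ) :
    intCoeff (f + g) i j n = intCoeff f i j n + intCoeff g i j n := by
  simp only [intCoeff]
  split_ifs <;> simp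

theorem intCoeff_sub (f g : PowerSeries ℚ[X][X]) (i j n : ℤ) :
    intCoeff (f - g) i j n = intCoeff f i j n - intCoeff g i j n := by
  simp only [intCoeff]
  split_ifs <;> simp

theorem intCoeff_one (i j n : ℤ) :
    intCoeff 1 i j n = if i = 0 ∧ j = 0 ∧ n = 0 then 1 else 0 := by
  rw [intCoeff]
  by_cases h : 0 ≤ i ∧ 0 ≤ j ∧ 0 ≤ n
  · obtain ⟨hi, hj, hn⟩ := h
    lift i to ℕ using hi
    lift j to ℕ using hj
    lift n to ℕ using hn
    simp only [Int.natCast_nonneg, and_self, if_true, Int.toNat_natCast, PowerSeries.coeff_one,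
      Nat.cast_eq_zero]
    by_cases h1 : n = 0 <;> by_cases h2 : j = 0 <;> by_cases h3 : i = 0 <;>
      simp [h1, h2, h3, Polynomial.coeff_one]
  · rw [if_neg h, if_neg (by omega)]

/-- The variable `x` in `ℚ[x][y]⟦t⟧`. -/
abbrev varx : PowerSeries ℚ[X][X] := PowerSeries.C (C X)

/-- The variable `y` in `ℚ[x][y]⟦t⟧`. -/
abbrev vary : PowerSeries ℚ[X][X] := PowerSeries.C X

/-- The variable `t` in `ℚ[x][y]⟦t⟧`. -/
abbrev vart : PowerSeries ℚ[X][X] := PowerSeries.X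

theorem intCoeff_varx_mul (f : PowerSeries ℚ[X][X]) (i j n : ℤ) :
    intCoeff (varx * f) i j n = intCoeff f (i - 1) j n := by
  rw [intCoeff, intCoeff, PowerSeries.coeff_C_mul, coeff_C_mul]
  rcases lt_trichotomy i 0 with hi | rfl | hi
  · rw [if_neg (by omega), if_neg (by omega)]
  · simp
  · obtain ⟨m, rfl⟩ : ∃ m : ℕ, i = m + 1 := ⟨(i - 1).toNat, by omega⟩
    have e : ((m : ℤ) + 1).toNat = m + 1 := by omega
    rw [e, coeff_X_mul]
    simp [hi.le]

theorem intCoeff_vary_mul (f : PowerSeries ℚ[X][X]) (i j n : ℤ) :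
    intCoeff (vary * f) i j n = intCoeff f i (j - 1) n := by
  rw [intCoeff, intCoeff, PowerSeries.coeff_C_mul]
  rcases lt_trichotomy j 0 with hi | rfl | hi
  · rw [if_neg (by omega), if_neg (by omega)]
  · simp
  · obtain ⟨m, rfl⟩ : ∃ m : ℕ, j = m + 1 := ⟨(j - 1).toNat, by omega⟩
    have e : ((m : ℤ) + 1).toNat = m + 1 := by omega
    rw [e, coeff_X_mul]
    simp [hi.le]

theorem intCoeff_vart_mul (f : PowerSeries ℚ[X][X]) (i j n : ℤ) :
    intCoeff (vart * f) i j n = intCoeff f i j (n - 1) := by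
  rw [intCoeff, intCoeff]
  rcases lt_trichotomy n 0 with hi | rfl | hi
  · rw [if_neg (by omega), if_neg (by omega)]
  · simp
  · obtain ⟨m, rfl⟩ : ∃ m : ℕ, n = m + 1 := ⟨(n - 1).toNat, by omega⟩
    have e : ((m : ℤ) + 1).toNat = m + 1 := by omega
    rw [e, PowerSeries.coeff_succ_X_mul]
    simp [hi.le]

/-- A series in `x` and `t`, as a series in `x`, `y` and `t`. -/
def inX : PowerSeries ℚ[X] →+* PowerSeries ℚ[X][X] := PowerSeries.map C

/-- A series in `x` and `t`, with `y` substituted for `x`. -/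
def inY : PowerSeries ℚ[X] →+* PowerSeries ℚ[X][X] := PowerSeries.map (mapRingHom C)

/-- A series in `t`, as a series in `x`, `y` and `t`. -/
def inT : PowerSeries ℚ →+* PowerSeries ℚ[X][X] := PowerSeries.map ((C : ℚ[X] →+* ℚ[X][X]).comp C)

theorem intCoeff_inX (f : PowerSeries ℚ[X]) (c : ℤ → ℤ → ℚ)
    (hc : ∀ i n : ℕ, (PowerSeries.coeff n f).coeff i = c i n)
    (hneg : ∀ i n : ℤ, i < 0 ∨ n < 0 → c i n = 0) (i j n : ℤ) :
    intCoeff (inX f) i j n = if j = 0 then c i n else 0 := by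
  rw [intCoeff, inX]
  by_cases h : 0 ≤ i ∧ 0 ≤ j ∧ 0 ≤ n
  · obtain ⟨hi, hj, hn⟩ := h
    lift i to ℕ using hi
    lift j to ℕ using hj
    lift n to ℕ using hn
    simp only [Int.natCast_nonneg, and_self, if_true, Int.toNat_natCast, PowerSeries.coeff_map,
      Nat.cast_eq_zero, coeff_C]
    split_ifs
    · exact hc i n
    · simp
  · rw [if_neg h]
    split_ifs
    · exact (hneg _ _ (by omega)).symm
    · rfl

theorem intCoeff_inY (f : PowerSeries ℚ[X]) (c : ℤ → ℤ → ℚ)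
    (hc : ∀ i n : ℕ, (PowerSeries.coeff n f).coeff i = c i n)
    (hneg : ∀ i n : ℤ, i < 0 ∨ n < 0 → c i n = 0) (i j n : ℤ) :
    intCoeff (inY f) i j n = if i = 0 then c j n else 0 := by
  rw [intCoeff, inY]
  by_cases h : 0 ≤ i ∧ 0 ≤ j ∧ 0 ≤ n
  · obtain ⟨hi, hj, hn⟩ := h
    lift i to ℕ using hi
    lift j to ℕ using hj
    lift n to ℕ using hn
    simp only [Int.natCast_nonneg, and_self, if_true, Int.toNat_natCast, PowerSeries.coeff_map,
      Nat.cast_eq_zero, coe_mapRingHom, coeff_map, coeff_C]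
    split_ifs
    · exact hc j n
    · simp
  · rw [if_neg h]
    split_ifs
    · exact (hneg _ _ (by omega)).symm
    · rfl

theorem intCoeff_inT (f : PowerSeries ℚ) (c : ℤ → ℚ)
    (hc : ∀ n : ℕ, PowerSeries.coeff n f = c n)
    (hneg : ∀ n : ℤ, n < 0 → c n = 0) (i j n : ℤ) :
    intCoeff (inT f) i j n = if i = 0 ∧ j = 0 then c n else 0 := by
  rw [intCoeff, inT]
  by_cases h : 0 ≤ i ∧ 0 ≤ j ∧ 0 ≤ n
  · obtain ⟨hi, hj, hn⟩ := h
    lift i to ℕ using hi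
    lift j to ℕ using hj
    lift n to ℕ using hn
    simp only [Int.natCast_nonneg, and_self, if_true, Int.toNat_natCast, PowerSeries.coeff_map,
      Nat.cast_eq_zero, RingHom.comp_apply, hc]
    by_cases h1 : i = 0 <;> by_cases h2 : j = 0 <;> simp [h1, h2, coeff_C]
  · rw [if_neg h]
    split_ifs
    · exact (hneg _ (by omega)).symm
    · rfl

theorem intCoeff_Q (i j n : ℤ) : intCoeff Q i j n = walkNum i j n := by
  by_cases h : 0 ≤ i ∧ 0 ≤ j ∧ 0 ≤ n
  · obtain ⟨hi, hj, hn⟩ := h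
    lift i to ℕ using hi
    lift j to ℕ using hj
    lift n to ℕ using hn
    rw [intCoeff_natCast, coeff_Q, walkNum_natCast]
  · rw [intCoeff, if_neg h, walkNum_of_neg (by omega)]

theorem intCoeff_inX_Qx0 (i j n : ℤ) :
    intCoeff (inX Qx0) i j n = if j = 0 then walkNum i 0 n else 0 :=
  intCoeff_inX Qx0 (fun i n => walkNum i 0 n)
    (fun i n => by rw [coeff_Qx0, ← walkNum_natCast, Nat.cast_zero])
    (fun i n h => walkNum_of_neg (by omega)) i j n

theorem intCoeff_inY_Qx0 (i j n : ℤ) :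
    intCoeff (inY Qx0) i j n = if i = 0 then walkNum j 0 n else 0 :=
  intCoeff_inY Qx0 (fun i n => walkNum i 0 n)
    (fun i n => by rw [coeff_Qx0, ← walkNum_natCast, Nat.cast_zero])
    (fun i n h => walkNum_of_neg (by omega)) i j n

theorem intCoeff_inX_Qd (i j n : ℤ) :
    intCoeff (inX Qd) i j n = if j = 0 then walkNum i i n else 0 :=
  intCoeff_inX Qd (fun i n => walkNum i i n)
    (fun i n => by rw [coeff_Qd, ← walkNum_natCast])
    (fun i n h => walkNum_of_neg (by omega)) i j n

theorem intCoeff_inT_Q00 (i j n : ℤ) :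
    intCoeff (inT Q00) i j n = if i = 0 ∧ j = 0 then walkNum 0 0 n else 0 :=
  intCoeff_inT Q00 (fun n => walkNum 0 0 n)
    (fun n => by rw [coeff_Q00, ← walkNum_natCast, Nat.cast_zero])
    (fun n h => walkNum_of_neg (by omega)) i j n

/-- A last step S or SW is forbidden from the x-axis, W or SW from the y-axis; SW from the origin is
then subtracted twice and is added back. By symmetry the walks ending on the y-axis have the series
Q(y,0). -/
theorem functional_equation :
    (varx * vary - vart * (varx ^ 2 * vary + vary + varx * vary ^ 2 + varx + varx ^ 2 * vary ^ 2
        + 1)) * Q =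
      varx * vary - vart * (1 + varx) * inX Qx0 - vart * (1 + vary) * inY Qx0
        + vart * inT Q00 := by
  -- The equation is expanded into nested products by single variables, so that each coefficient is
  -- read off by index shifts.
  have key : varx * (vary * Q) - vart * (varx * (varx * (vary * Q)) + vary * Q
      + varx * (vary * (vary * Q)) + varx * Q + varx * (varx * (vary * (vary * Q))) + Q) =
      varx * (vary * 1) - vart * (inX Qx0 + varx * inX Qx0) - vart * (inY Qx0 + vary * inY Qx0)
        + vart * inT Q00 := by
    refine eq_of_intCoeff fun i j n => ?_
    simp only [intCoeff_add, intCoeff_sub, intCoeff_varx_mul, intCoeff_vary_mul, intCoeff_vart_mul,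
      intCoeff_one, intCoeff_Q, intCoeff_inX_Qx0, intCoeff_inY_Qx0, intCoeff_inT_Q00]
    -- The factor xy shifts the endpoint to (i-1, j-1). The recurrence is needed only for i, j > 0;
    -- the rows i = 0 and j = 0 check that the boundary terms cancel.
    rcases lt_trichotomy i 0 with hi | rfl | hi <;> rcases lt_trichotomy j 0 with hj | rfl | hj
    · have : i - 1 ≠ 0 := by omega
      simp (disch := omega) [walkNum_of_neg, hi.ne, hj.ne, this]
    · simp (disch := omega) [walkNum_of_neg, hi.ne]
    · have : i - 1 ≠ 0 := by omega
      simp (disch := omega) [walkNum_of_neg, hi.ne, this]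
    · simp (disch := omega) [walkNum_of_neg, hj.ne]
    · simp (disch := omega) [walkNum_of_neg]
    · simp (disch := omega) [walkNum_of_neg, hj.ne', walkNum_symm j 0, walkNum_symm (j - 1) 0]
      ring
    · have : j - 1 ≠ 0 := by omega
      simp (disch := omega) [walkNum_of_neg, hj.ne, this]
    · simp (disch := omega) [walkNum_of_neg, hi.ne']
      ring
    · obtain ⟨a, rfl⟩ : ∃ a, i = a + 1 := ⟨i - 1, by omega⟩
      obtain ⟨b, rfl⟩ : ∃ b, j = b + 1 := ⟨j - 1, by omega⟩
      simp only [add_sub_cancel_right, hi.ne', hj.ne', false_and, if_false]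
      rw [walkNum_rec (by omega) (by omega) n]
      ring
  linear_combination key

/-- The generating function of walks ending weakly below the diagonal: the coefficient of
`x^j y^d t^n` is the number of walks of length `n` ending at `(j + d, j)`. -/
def lowerQ : PowerSeries ℚ[X][X] :=
  PowerSeries.mk fun n => ∑ d ∈ Finset.range (n + 1), ∑ j ∈ Finset.range (n + 1),
    monomial d (monomial j (q (j + d) j n : ℚ))

theorem coeff_lowerQ (d j n : ℕ) :
    ((PowerSeries.coeff n lowerQ).coeff d).coeff j = (q (j + d) j n : ℚ) := by
  simp only [lowerQ, PowerSeries.coeff_mk, finsetSum_coeff, coeff_monomial]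
  by_cases h : n < d ∨ n < j
  · rw [q_eq_zero (by omega), Nat.cast_zero]
    refine Finset.sum_eq_zero fun a ha => Finset.sum_eq_zero fun b hb => ?_
    rw [Finset.mem_range] at ha hb
    split_ifs with h1
    · rw [coeff_monomial, if_neg (by omega)]
    · rw [coeff_zero]
  · push Not at h
    rw [Finset.sum_eq_single d, Finset.sum_eq_single j]
    · simp
    · intro b _ hb
      simp [coeff_monomial, hb]
    · intro hj
      exact (hj (by rw [Finset.mem_range]; omega)).elim
    · intro a _ ha
      simp [ha]
    · intro hd
      exact (hd (by rw [Finset.mem_range]; omega)).elim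

theorem intCoeff_lowerQ (j d n : ℤ) :
    intCoeff lowerQ j d n = if 0 ≤ d then walkNum (j + d) j n else 0 := by
  by_cases h : 0 ≤ j ∧ 0 ≤ d ∧ 0 ≤ n
  · obtain ⟨hj, hd, hn⟩ := h
    lift j to ℕ using hj
    lift d to ℕ using hd
    lift n to ℕ using hn
    rw [intCoeff_natCast, coeff_lowerQ, if_pos (Int.natCast_nonneg d), ← walkNum_natCast,
      Nat.cast_add]
  · rw [intCoeff, if_neg h]
    split_ifs
    · rw [walkNum_of_neg (by omega)]
    · rfl

/-- In the coordinates (j+d, j) the steps E, W, N, S, NE, SW have weights y, 1/y, x/y, y/x, x, 1/x,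
which gives this kernel. A diagonal point is entered equally often from below and from above, by
symmetry; the factor 2 accounts for both sides at once. The other terms remove steps leaving through
the diagonal or the x-axis and restore SW from the origin. -/
theorem lower_functional_equation :
    2 * (varx * vary - vart * (varx * vary ^ 2 + vary ^ 2 + varx ^ 2 * vary + vary + varx
        + varx ^ 2)) * lowerQ =
      varx * vary + vart * vary * inT Q00
        + (vary * (varx - vart * (varx ^ 2 + 1)) - 2 * vart * varx * (1 + varx)) * inX Qd
        - 2 * vart * vary * (1 + vary) * inY Qx0 := by
  have key : (varx * (vary * lowerQ) - vart * (varx * (vary * (vary * lowerQ))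
      + vary * (vary * lowerQ) + varx * (varx * (vary * lowerQ)) + vary * lowerQ + varx * lowerQ
      + varx * (varx * lowerQ))) + (varx * (vary * lowerQ) - vart * (varx * (vary * (vary * lowerQ))
      + vary * (vary * lowerQ) + varx * (varx * (vary * lowerQ)) + vary * lowerQ + varx * lowerQ
      + varx * (varx * lowerQ))) =
      varx * (vary * 1) + vart * (vary * inT Q00)
        + vary * (varx * inX Qd - vart * (varx * (varx * inX Qd) + inX Qd))
        - vart * (varx * inX Qd + varx * (varx * inX Qd))
        - vart * (varx * inX Qd + varx * (varx * inX Qd))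
        - vart * (vary * inY Qx0 + vary * (vary * inY Qx0))
        - vart * (vary * inY Qx0 + vary * (vary * inY Qx0)) := by
    refine eq_of_intCoeff fun j d n => ?_
    simp only [intCoeff_add, intCoeff_sub, intCoeff_varx_mul, intCoeff_vary_mul, intCoeff_vart_mul,
      intCoeff_one, intCoeff_lowerQ, intCoeff_inX_Qd, intCoeff_inY_Qx0, intCoeff_inT_Q00]
    -- Because of the factor y, the diagonal sits at d = 1, and d = 0 collects the steps that cross
    -- it.
    have hd : d < 0 ∨ d = 0 ∨ d = 1 ∨ 1 < d := by omega
    rcases lt_trichotomy j 0 with hj | rfl | hj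
    · have h1 : j ≠ 0 := hj.ne
      have h2 : j ≠ 1 := by omega
      rcases hd with hd | rfl | rfl | hd <;> simp (disch := omega) [walkNum_of_neg, h1, sub_eq_zero, h2]
    · rcases hd with hd | rfl | rfl | hd
      · have : d - 1 ≠ 0 := by omega
        have : d - 1 - 1 ≠ 0 := by omega
        simp (disch := omega) [walkNum_of_neg, *]
      · simp (disch := omega) [walkNum_of_neg]
      · simp (disch := omega) [walkNum_of_neg]
        ring
      · have h1 : d ≠ 0 := by omega
        have h2 : d - 1 ≠ 0 := by omega
        simp (disch := omega) [walkNum_of_neg, h1, h2, if_pos]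
        ring
    · obtain ⟨a, rfl⟩ : ∃ a, j = a + 1 := ⟨j - 1, by omega⟩
      have ha : 0 ≤ a := by omega
      have h1 : a + 1 ≠ 0 := by omega
      rcases hd with hd | rfl | rfl | hd
      · have h2 : d - 1 ≠ 0 := by omega
        simp (disch := omega) only [walkNum_of_neg, h1, h2, if_neg, false_and, and_false, hd.ne, if_false]
        ring
      · simp (disch := omega) only [walkNum_of_neg, h1, if_neg, false_and, if_false, if_true,
          zero_sub, if_pos, add_sub_cancel_right, add_zero]
        ring
      · simp (disch := omega) only [if_neg, if_pos, if_true, add_sub_cancel_right, sub_self, add_zero,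
          sub_add_cancel]
        rw [walkNum_rec (a := a) (b := a) ha ha n, walkNum_symm a (a + 1), walkNum_symm (a - 1) a]
        simp only [← and_assoc, and_self, and_true]
        ring
      · obtain ⟨b, rfl⟩ : ∃ b, d = b + 1 := ⟨d - 1, by omega⟩
        simp (disch := omega) only [if_neg, if_pos, add_sub_cancel_right]
        rw [walkNum_rec (a := a + b) (by omega) (by omega) n, if_neg (by omega),
          show a + (b - 1) = a + b - 1 by ring, show a + 1 + (b - 1) = a + b by ring,
          show a - 1 + b = a + b - 1 by ring, show a + 1 + b = a + b + 1 by ring,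
          show a + (b + 1) = a + b + 1 by ring, show a - 1 + (b + 1) = a + b by ring]
        ring
  linear_combination key

end FunctionalEquations

/-! ### Existence and uniqueness of Z and of the square root of Δ₊. -/

section ZAndRoot

/-- The polynomial `1 - 2z + 6z² - 2z³ + z⁴` of the equation that defines `Z`. -/
def zPoly {A : Type*} [CommRing A] (z : A) : A := 1 - 2 * z + 6 * z ^ 2 - 2 * z ^ 3 + z ^ 4

theorem map_zPoly {A B : Type*} [CommRing A] [CommRing B] (f : A →+* B) (z : A) :
    f (zPoly z) = zPoly (f z) := by
  simp [zPoly, map_ofNat]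

theorem isZ_iff (Z : PowerSeries ℚ) :
    IsZ Z ↔ PowerSeries.constantCoeff Z = 0 ∧ Z * (1 - Z) ^ 2 = PowerSeries.X * zPoly Z := by
  refine and_congr_right fun h => ?_
  have hc : PowerSeries.constantCoeff ((1 - Z) ^ 2) ≠ 0 := by simp [h]
  rw [PowerSeries.eq_mul_inv_iff_mul_eq hc, zPoly]

theorem existsUnique_isZ : ∃! Z : PowerSeries ℚ, IsZ Z := by
  -- With Z = tw, division by t turns the equation into w(1-tw)² = `zPoly (tw)`. Solved for the
  -- linear w, its right side is contracting, as every power of w carries a factor t.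
  obtain ⟨w, hw, huniq⟩ := existsUnique_fixedPoint (R := ℚ)
    (fun w => zPoly (PowerSeries.X * w) + 2 * PowerSeries.X * w ^ 2 - PowerSeries.X ^ 2 * w ^ 3)
    (fun f g => ⟨-2 + 6 * PowerSeries.X * (f + g) - 2 * PowerSeries.X ^ 2 * (f ^ 2 + f * g + g ^ 2)
      + PowerSeries.X ^ 3 * (f ^ 3 + f ^ 2 * g + f * g ^ 2 + g ^ 3) + 2 * (f + g)
      - PowerSeries.X * (f ^ 2 + f * g + g ^ 2), by simp only [zPoly]; ring⟩)
  refine ⟨PowerSeries.X * w, ?_, ?_⟩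
  · change IsZ _
    rw [isZ_iff]
    refine ⟨by simp, ?_⟩
    linear_combination -PowerSeries.X * hw
  · intro Z hZ
    rw [isZ_iff] at hZ
    obtain ⟨v, rfl⟩ := PowerSeries.X_dvd_iff.2 hZ.1
    rw [huniq v]
    refine mul_left_cancel₀ PowerSeries.X_ne_zero ?_
    linear_combination -hZ.2

/-- `(1 - z)² Δ₊(x)`, as a polynomial in `z` and `x`. -/
def discPoly {A : Type*} [CommRing A] (z x : A) : A :=
  (1 - z) ^ 2 * (1 + z ^ 2 * x ^ 2) - 2 * z * (1 + z ^ 2) * x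

theorem map_discPoly {A B : Type*} [CommRing A] [CommRing B] (f : A →+* B) (z x : A) :
    f (discPoly z x) = discPoly (f z) (f x) := by
  simp [discPoly, map_ofNat]

/-- The inclusion of `ℚ⟦t⟧` in `ℚ[x]⟦t⟧`. -/
abbrev constX : PowerSeries ℚ →+* PowerSeries ℚ[X] := PowerSeries.map C

/-- The variable `x` of `ℚ[x]⟦t⟧`. -/
abbrev serX : PowerSeries ℚ[X] := PowerSeries.C X

theorem toF_injective : Function.Injective toF :=
  IsFractionRing.injective (PowerSeries ℚ[X]) F

theorem constX_injective : Function.Injective constX :=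
  PowerSeries.map_injective _ C_injective

theorem constToF_apply (f : PowerSeries ℚ) : constToF f = toF (constX f) := rfl

theorem one_sub_ne_zero {A : Type*} [CommRing A] [Nontrivial A] {z : PowerSeries A}
    (h : PowerSeries.constantCoeff z = 0) : 1 - z ≠ 0 := by
  intro h0
  have := congrArg PowerSeries.constantCoeff h0
  simp [h] at this

theorem constantCoeff_constX (f : PowerSeries ℚ) :
    PowerSeries.constantCoeff (constX f) = C (PowerSeries.constantCoeff f) := by
  rw [← PowerSeries.coeff_zero_eq_constantCoeff_apply, PowerSeries.coeff_map,
    PowerSeries.coeff_zero_eq_constantCoeff_apply]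

theorem isSqrtDeltaPlus_iff {Z : PowerSeries ℚ} (hZ : PowerSeries.constantCoeff Z = 0)
    (R : PowerSeries ℚ[X]) :
    IsSqrtDeltaPlus (constToF Z) R ↔ PowerSeries.constantCoeff R = 1 ∧
      (1 - constX Z) ^ 2 * R ^ 2 = discPoly (constX Z) serX := by
  refine and_congr_right fun _ => ?_
  have h1 : 1 - constX Z ≠ 0 := one_sub_ne_zero (by rw [constantCoeff_constX, hZ, C_0])
  have h2 : (1 - constToF Z) ≠ 0 := by
    rw [constToF_apply, ← map_one toF, ← map_sub]
    exact (map_ne_zero_iff _ toF_injective).2 h1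
  rw [← toF_injective.eq_iff, map_discPoly]
  rw [map_mul, map_pow, map_pow, map_sub, map_one]
  change toF R ^ 2 = deltaPlus (constToF Z) ↔ _ = discPoly (constToF Z) x
  rw [← mul_right_inj' (pow_ne_zero 2 h2)]
  have : (1 - constToF Z) ^ 2 * deltaPlus (constToF Z) = discPoly (constToF Z) x := by
    rw [deltaPlus, discPoly]
    field_simp
    ring
  rw [this, constToF_apply]

theorem existsUnique_isSqrtDeltaPlus {Z : PowerSeries ℚ} (hZ : PowerSeries.constantCoeff Z = 0) :
    ∃! R : PowerSeries ℚ[X], IsSqrtDeltaPlus (constToF Z) R := by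
  have h1 : 1 - constX Z ≠ 0 := one_sub_ne_zero (by rw [constantCoeff_constX, hZ, C_0])
  obtain ⟨w, hw⟩ := PowerSeries.X_dvd_iff.2 hZ
  let z := constX Z
  let v := constX w
  let u := constX ((1 - Z) ^ 2)⁻¹
  have hz : z = PowerSeries.X * v := by
    change constX Z = _
    rw [hw]
    simp [v]
  have hu : (1 - z) ^ 2 * u = 1 := by
    have hc : PowerSeries.constantCoeff ((1 - Z) ^ 2) ≠ 0 := by simp [hZ]
    have := congrArg constX (PowerSeries.mul_inv_cancel _ hc)
    simpa only [map_mul, map_pow, map_sub, map_one] using this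
  have hhalf : (2 : PowerSeries ℚ[X]) * PowerSeries.C (C (1 / 2)) = 1 := by
    rw [← map_ofNat (PowerSeries.C.comp C : ℚ →+* PowerSeries ℚ[X]) 2]
    rw [RingHom.comp_apply, ← map_mul, ← map_mul]
    norm_num
  -- Writing the root as 1 + tr and dividing Δ₊ - 1 by t leaves 2r + tr² = (Δ₊ - 1)/t, which is
  -- contracting when solved for r.
  obtain ⟨r, hr, -⟩ := existsUnique_fixedPoint (R := ℚ[X])
    (fun r => PowerSeries.C (C (1 / 2)) *
      (v * z * serX ^ 2 - 2 * v * (1 + z ^ 2) * u * serX - PowerSeries.X * r ^ 2))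
    (fun f g => ⟨-PowerSeries.C (C (1 / 2)) * (f + g), by ring⟩)
  have hR' : (1 - z) ^ 2 * (1 + PowerSeries.X * r) ^ 2 = discPoly z serX := by
    rw [discPoly]
    generalize (PowerSeries.C (C (1 / 2)) : PowerSeries ℚ[X]) = c at hr hhalf
    generalize (PowerSeries.X : PowerSeries ℚ[X]) = t at hr hz ⊢
    generalize (serX : PowerSeries ℚ[X]) = y at hr ⊢
    have e : 2 * r = v * z * y ^ 2 - 2 * v * (1 + z ^ 2) * u * y - t * r ^ 2 := by
      linear_combination -2 * hr
        + (v * z * y ^ 2 - 2 * v * (1 + z ^ 2) * u * y - t * r ^ 2) * hhalf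
    linear_combination (1 - z) ^ 2 * t * e - 2 * t * v * (1 + z ^ 2) * y * hu
      + (2 * (1 + z ^ 2) * y - (1 - z) ^ 2 * z * y ^ 2) * hz
  refine ⟨1 + PowerSeries.X * r, (isSqrtDeltaPlus_iff hZ _).2 ⟨by simp, hR'⟩, ?_⟩
  · intro R hR
    rw [isSqrtDeltaPlus_iff hZ] at hR
    have h2 := mul_left_cancel₀ (pow_ne_zero 2 h1) (hR.2.trans hR'.symm)
    rcases sq_eq_sq_iff_eq_or_eq_neg.1 h2 with h3 | h3
    · exact h3
    · have := congrArg PowerSeries.constantCoeff h3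
      rw [hR.1] at this
      simp only [map_neg, map_add, map_mul, map_one, PowerSeries.constantCoeff_X, zero_mul,
        add_zero] at this
      exact absurd this (by
        intro h4
        have := congrArg (eval 0) h4
        norm_num at this)

end ZAndRoot

/-! ### Substituting power series in t for x and y. -/

section Evaluation

variable {S : Type*} [CommRing S] [Algebra ℚ S]

/-- Substitution of `a` for `x` in a series with coefficients in `ℚ[x]`. -/
def evX (a : PowerSeries S) : PowerSeries ℚ[X] →+* PowerSeries S :=
  evalSeries (eval₂RingHom (algebraMap ℚ (PowerSeries S)) a)

/-- Substitution of `a` for `x` and `b` for `y` in a series with coefficients in `ℚ[x][y]`. -/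
def evXY (a b : PowerSeries S) : PowerSeries ℚ[X][X] →+* PowerSeries S :=
  evalSeries (eval₂RingHom (eval₂RingHom (algebraMap ℚ (PowerSeries S)) a) b)

variable (S) in
/-- The inclusion of `ℚ⟦t⟧` in `S⟦t⟧`. -/
def constS : PowerSeries ℚ →+* PowerSeries S := PowerSeries.map (algebraMap ℚ S)

variable (a b : PowerSeries S)

@[simp] theorem evX_serX : evX a serX = a := by simp [evX]

@[simp] theorem evX_X : evX a PowerSeries.X = PowerSeries.X := by simp [evX]

@[simp] theorem evXY_varx : evXY a b varx = a := by simp [evXY]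

@[simp] theorem evXY_vary : evXY a b vary = b := by simp [evXY]

@[simp] theorem evXY_X : evXY a b PowerSeries.X = PowerSeries.X := by simp [evXY]

theorem constS_eq_evalSeries (f : PowerSeries ℚ) :
    constS S f = evalSeries (algebraMap ℚ (PowerSeries S)) f := by
  rw [constS, map_eq_evalSeries]
  congr 2
  exact Subsingleton.elim _ _

@[simp] theorem evX_constX (f : PowerSeries ℚ) : evX a (constX f) = constS S f := by
  rw [evX, evalSeries_map, constS_eq_evalSeries]
  congr 2
  exact Subsingleton.elim _ _

@[simp] theorem evXY_inT (f : PowerSeries ℚ) : evXY a b (inT f) = constS S f := by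
  rw [evXY, inT, evalSeries_map, constS_eq_evalSeries]
  congr 2
  exact Subsingleton.elim _ _

@[simp] theorem evXY_inX (f : PowerSeries ℚ[X]) : evXY a b (inX f) = evX a f := by
  rw [evXY, inX, evalSeries_map, evX]
  congr 2
  ext <;> simp

@[simp] theorem evXY_inY (f : PowerSeries ℚ[X]) : evXY a b (inY f) = evX b f := by
  rw [evXY, inY, evalSeries_map, evX]
  congr 2
  ext <;> simp

theorem constantCoeff_evX (f : PowerSeries ℚ[X]) : PowerSeries.constantCoeff (evX a f) =
    (PowerSeries.constantCoeff f).eval₂ (algebraMap ℚ S) (PowerSeries.constantCoeff a) := by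
  rw [evX, constantCoeff_evalSeries, coe_eval₂RingHom, hom_eval₂]
  congr 1

/-- A substituted value that is constant in t acts on each coefficient separately. This is used for
x = 0 and for the embedding of ℚ[x] in ℚ(x). -/
theorem evX_C_eq_map {A : Type*} [CommRing A] [Algebra ℚ A] (ψ : ℚ[X] →+* A)
    (f : PowerSeries ℚ[X]) : evX (PowerSeries.C (ψ X)) f = PowerSeries.map ψ f := by
  rw [map_eq_evalSeries, evX]
  congr 2
  exact ringHom_ext' (Subsingleton.elim _ _) (by simp)

theorem exists_eq_serX_mul {f : PowerSeries ℚ[X]}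
    (hf : evX (0 : PowerSeries ℚ) f = 0) : ∃ g, f = serX * g := by
  refine ⟨PowerSeries.mk fun n => divX (PowerSeries.coeff n f), ?_⟩
  ext1 n
  rw [PowerSeries.coeff_C_mul, PowerSeries.coeff_mk]
  have h0 : (PowerSeries.coeff n f).coeff 0 = 0 := by
    have h1 := evX_C_eq_map (evalRingHom (0 : ℚ)) f
    rw [coe_evalRingHom, eval_X, map_zero, hf] at h1
    have := congrArg (PowerSeries.coeff n) h1
    rw [PowerSeries.coeff_map, coe_evalRingHom, ← coeff_zero_eq_eval_zero] at this
    simpa using this.symm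
  have := X_mul_divX_add (PowerSeries.coeff n f)
  rw [h0, C_0, add_zero] at this
  exact this.symm

end Evaluation

/-! ### Invariants on the kernel curve, and the kernel root. -/

section Invariants

/-- The kernel polynomial `x²y + y + xy² + x + x²y² + 1`. -/
def kerPoly {A : Type*} [CommRing A] (x y : A) : A :=
  x ^ 2 * y + y + x * y ^ 2 + x + x ^ 2 * y ^ 2 + 1

/-- The kernel polynomial in the variables `x` and `v = xy`. -/
def kerPoly' {A : Type*} [CommRing A] (x v : A) : A :=
  x * v ^ 2 + v ^ 2 + x ^ 2 * v + v + x + x ^ 2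

/-- The factor `z(1-z) + 2xz - (1-z)x²` of `√Δ₊(x)` in `Q(x,0;t)`. -/
def sqrtFactor {A : Type*} [CommRing A] (z x : A) : A := z * (1 - z) + 2 * x * z - (1 - z) * x ^ 2

/-- The polynomial `1 - z - 2xz - x²z(1-z)`. -/
def diagFactor {A : Type*} [CommRing A] (z x : A) : A := 1 - z - 2 * x * z - x ^ 2 * z * (1 - z)

theorem map_sqrtFactor {A B : Type*} [CommRing A] [CommRing B] (f : A →+* B) (z x : A) :
    f (sqrtFactor z x) = sqrtFactor (f z) (f x) := by
  simp [sqrtFactor, map_ofNat]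

theorem map_diagFactor {A B : Type*} [CommRing A] [CommRing B] (f : A →+* B) (z x : A) :
    f (diagFactor z x) = diagFactor (f z) (f x) := by
  simp [diagFactor, map_ofNat]

/-- Up to denominators, this says that S(x)²Δ₊(x)/(x²(1+x)²) takes the same value at x and y on the
kernel curve. Eliminating t between the equations of z and of the kernel leaves one polynomial
relation, of which the difference of both sides is an explicit multiple. -/
theorem sqrtFactor_sq_invariant {A : Type*} [CommRing A] {t z x y : A}
    (hz : z * (1 - z) ^ 2 = t * zPoly z) (hy : x * y = t * kerPoly x y) :
    y ^ 2 * (1 + y) ^ 2 * sqrtFactor z x ^ 2 * discPoly z x =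
      x ^ 2 * (1 + x) ^ 2 * sqrtFactor z y ^ 2 * discPoly z y := by
  have h : x * y * zPoly z = z * (1 - z) ^ 2 * kerPoly x y := by
    linear_combination zPoly z * hy - kerPoly x y * hz
  simp only [zPoly, kerPoly] at h
  simp only [sqrtFactor, discPoly]
  linear_combination (
      - z ^ 4 * x ^ 3 * y - 2 * z ^ 4 * x ^ 2 * y + z ^ 4 * x * y ^ 3 + 2 * z ^ 4 * x * y
      ^ 2 - z ^ 3 * x ^ 4 * y ^ 2 - z ^ 3 * x ^ 4 * y - 3 * z ^ 3 * x ^ 3 * y ^ 2 - 2 * z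
      ^ 3 * x ^ 3 * y + z ^ 3 * x ^ 3 + z ^ 3 * x ^ 2 * y ^ 4 + 3 * z ^ 3 * x ^ 2 * y ^ 3
      - z ^ 3 * x ^ 2 * y + z ^ 3 * x ^ 2 + z ^ 3 * x * y ^ 4 + 2 * z ^ 3 * x * y ^ 3 + z
      ^ 3 * x * y ^ 2 - z ^ 3 * y ^ 3 - z ^ 3 * y ^ 2 + 2 * z ^ 2 * x ^ 4 * y ^ 2 + 2 * z
      ^ 2 * x ^ 4 * y + 4 * z ^ 2 * x ^ 3 * y ^ 2 - 2 * z ^ 2 * x ^ 3 - 2 * z ^ 2 * x ^ 2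
      * y ^ 4 - 4 * z ^ 2 * x ^ 2 * y ^ 3 - 4 * z ^ 2 * x ^ 2 * y - 2 * z ^ 2 * x ^ 2 - 2
      * z ^ 2 * x * y ^ 4 + 4 * z ^ 2 * x * y ^ 2 + 2 * z ^ 2 * y ^ 3 + 2 * z ^ 2 * y ^ 2
      - z * x ^ 4 * y ^ 2 - z * x ^ 4 * y + z * x ^ 3 * y ^ 2 + 2 * z * x ^ 3 * y + z * x
      ^ 3 + z * x ^ 2 * y ^ 4 - z * x ^ 2 * y ^ 3 + 3 * z * x ^ 2 * y + z * x ^ 2 + z * x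
      * y ^ 4 - 2 * z * x * y ^ 3 - 3 * z * x * y ^ 2 - z * y ^ 3 - z * y ^ 2 + 2 * x ^ 3
      * y ^ 2 + x ^ 3 * y - 2 * x ^ 2 * y ^ 3 - x * y ^ 3) * h

/-- The square of the relation that eliminates v from the diagonal equation. Here too it is a
multiple of the relation left after eliminating t. -/
theorem diagFactor_sq_eq {A : Type*} [CommRing A] {t z x v : A}
    (hz : z * (1 - z) ^ 2 = t * zPoly z) (hv : x * v = t * kerPoly' x v) :
    (x - v ^ 2) ^ 2 * diagFactor z x ^ 2 * z ^ 2 * (1 + v) ^ 2 * (1 - z) ^ 4 =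
      x ^ 2 * sqrtFactor z v ^ 2 * discPoly z x * discPoly z v := by
  have h : x * v * zPoly z = z * (1 - z) ^ 2 * kerPoly' x v := by
    linear_combination zPoly z * hv - kerPoly' x v * hz
  simp only [zPoly, kerPoly'] at h
  simp only [sqrtFactor, discPoly, diagFactor]
  linear_combination (
      - z ^ 8 * x ^ 3 * v - z ^ 7 * x ^ 4 * v - z ^ 7 * x ^ 4 + 2 * z ^ 7 * x ^ 3 * v ^ 3
      + 3 * z ^ 7 * x ^ 3 * v ^ 2 + 4 * z ^ 7 * x ^ 3 * v + z ^ 7 * x ^ 3 - z ^ 7 * x ^ 2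
      * v ^ 2 + z ^ 7 * x ^ 2 * v + 4 * z ^ 6 * x ^ 4 * v + 4 * z ^ 6 * x ^ 4 - 8 * z ^ 6
      * x ^ 3 * v ^ 3 - 12 * z ^ 6 * x ^ 3 * v ^ 2 - 7 * z ^ 6 * x ^ 3 * v + 2 * z ^ 6 * x
      ^ 2 * v ^ 4 - 2 * z ^ 6 * x ^ 2 - z ^ 6 * x * v ^ 3 - 6 * z ^ 5 * x ^ 4 * v - 6 * z
      ^ 5 * x ^ 4 + 12 * z ^ 5 * x ^ 3 * v ^ 3 + 18 * z ^ 5 * x ^ 3 * v ^ 2 + 4 * z ^ 5 *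
      x ^ 3 * v - 6 * z ^ 5 * x ^ 3 - 8 * z ^ 5 * x ^ 2 * v ^ 4 - 3 * z ^ 5 * x ^ 2 * v ^
      3 + 9 * z ^ 5 * x ^ 2 * v ^ 2 + 10 * z ^ 5 * x ^ 2 * v - 3 * z ^ 5 * x * v ^ 4 + 3 *
      z ^ 5 * x * v ^ 2 + 2 * z ^ 5 * x * v - z ^ 5 * v ^ 4 - z ^ 5 * v ^ 3 + 4 * z ^ 4 *
      x ^ 4 * v + 4 * z ^ 4 * x ^ 4 - 8 * z ^ 4 * x ^ 3 * v ^ 3 - 12 * z ^ 4 * x ^ 3 * v ^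
      2 + z ^ 4 * x ^ 3 * v + 8 * z ^ 4 * x ^ 3 + 8 * z ^ 4 * x ^ 2 * v ^ 4 - 8 * z ^ 4 *
      x ^ 2 * v ^ 3 - 32 * z ^ 4 * x ^ 2 * v ^ 2 - 8 * z ^ 4 * x ^ 2 * v + 8 * z ^ 4 * x ^
      2 + 8 * z ^ 4 * x * v ^ 4 + z ^ 4 * x * v ^ 3 - 12 * z ^ 4 * x * v ^ 2 - 8 * z ^ 4 *
      x * v + 4 * z ^ 4 * v ^ 4 + 4 * z ^ 4 * v ^ 3 - z ^ 3 * x ^ 4 * v - z ^ 3 * x ^ 4 +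
      2 * z ^ 3 * x ^ 3 * v ^ 3 + 3 * z ^ 3 * x ^ 3 * v ^ 2 - 3 * z ^ 3 * x ^ 3 + 10 * z ^
      3 * x ^ 2 * v ^ 3 + 9 * z ^ 3 * x ^ 2 * v ^ 2 - 3 * z ^ 3 * x ^ 2 * v - 8 * z ^ 3 *
      x ^ 2 - 6 * z ^ 3 * x * v ^ 4 + 4 * z ^ 3 * x * v ^ 3 + 18 * z ^ 3 * x * v ^ 2 + 12
      * z ^ 3 * x * v - 6 * z ^ 3 * v ^ 4 - 6 * z ^ 3 * v ^ 3 - z ^ 2 * x ^ 3 * v - 2 * z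
      ^ 2 * x ^ 2 * v ^ 4 + 2 * z ^ 2 * x ^ 2 - 7 * z ^ 2 * x * v ^ 3 - 12 * z ^ 2 * x * v
      ^ 2 - 8 * z ^ 2 * x * v + 4 * z ^ 2 * v ^ 4 + 4 * z ^ 2 * v ^ 3 + z * x ^ 2 * v ^ 3
      - z * x ^ 2 * v ^ 2 + z * x * v ^ 4 + 4 * z * x * v ^ 3 + 3 * z * x * v ^ 2 + 2 * z
      * x * v - z * v ^ 4 - z * v ^ 3 - x * v ^ 3) * h

open PowerSeries (constantCoeff)

variable {K : Type*} [Field K]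

/-- The squares agree, so the two terms are equal up to sign, and their lowest coefficients in t
decide which sign holds. -/
theorem sqrtFactor_antiinvariant [CharZero K] {z z' s r y y' : PowerSeries K} {a : K}
    (hz' : z = PowerSeries.X * z') (hz1 : constantCoeff z' = 1) (ha : a ≠ 0) (ha1 : 1 + a ≠ 0)
    (hy' : y = PowerSeries.X * y') (hy1 : a * constantCoeff y' = 1 + a)
    (hz : z * (1 - z) ^ 2 = PowerSeries.X * zPoly z)
    (hy : PowerSeries.C a * y = PowerSeries.X * kerPoly (PowerSeries.C a) y)
    (hs0 : constantCoeff s = 1) (hr0 : constantCoeff r = 1)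
    (hs : (1 - z) ^ 2 * s ^ 2 = discPoly z (PowerSeries.C a))
    (hr : (1 - z) ^ 2 * r ^ 2 = discPoly z y) :
    y * (1 + y) * sqrtFactor z (PowerSeries.C a) * s
      + PowerSeries.C a * (1 + PowerSeries.C a) * sqrtFactor z y * r = 0 := by
  have h1 : (1 - z) ≠ 0 := one_sub_ne_zero (by rw [hz']; simp)
  have hsq := sqrtFactor_sq_invariant hz hy
  set A := PowerSeries.C a with hA
  have hmul : (y * (1 + y) * sqrtFactor z A * s + A * (1 + A) * sqrtFactor z y * r) *
      (y * (1 + y) * sqrtFactor z A * s - A * (1 + A) * sqrtFactor z y * r) = 0 := by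
    refine (mul_eq_zero.1 ?_).resolve_left (pow_ne_zero 2 h1)
    linear_combination hsq + y ^ 2 * (1 + y) ^ 2 * sqrtFactor z A ^ 2 * hs
      - A ^ 2 * (1 + A) ^ 2 * sqrtFactor z y ^ 2 * hr
  refine (mul_eq_zero.1 hmul).resolve_right fun h0 => ?_
  -- After division by t the terms have constant coefficients -a(1+a) and a(1+a), so their
  -- difference cannot vanish.
  have e : PowerSeries.X * (y' * (1 + y) * sqrtFactor z A * s
      - A * (1 + A) * (z' * (1 - z) + 2 * y' * z - (1 - z) * (y' * y)) * r) =
      PowerSeries.X * 0 := by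
    rw [mul_zero, ← h0]
    simp only [sqrtFactor]
    linear_combination (- (1 + y) * (z * (1 - z) + 2 * A * z - (1 - z) * A ^ 2) * s
        + A * (1 + A) * r * (2 * z - (1 - z) * y)) * hy'
      + A * (1 + A) * r * (1 - z) * hz'
  have e' := congrArg PowerSeries.constantCoeff (mul_left_cancel₀ PowerSeries.X_ne_zero e)
  have cy : constantCoeff y = 0 := by simp [hy']
  have cz : constantCoeff z = 0 := by simp [hz']
  simp only [sqrtFactor, map_sub, map_mul, map_add, map_one, map_pow, map_ofNat, hA,
    PowerSeries.constantCoeff_C, cy, cz, hs0, hr0, hz1, map_zero] at e'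
  have : a * (1 + a) * 2 = 0 := by linear_combination -e' - a * hy1
  simp [ha, ha1] at this

/-- Again the sign is fixed by the lowest order: both sides are at + O(t²), so their sum is not
zero. -/
theorem diagFactor_eq [CharZero K] {z z' s r v : PowerSeries K} {a : K}
    (hz' : z = PowerSeries.X * z') (hz1 : constantCoeff z' = 1) (ha : a ≠ 0)
    (hv0 : PowerSeries.X ∣ v)
    (hz : z * (1 - z) ^ 2 = PowerSeries.X * zPoly z)
    (hv : PowerSeries.C a * v = PowerSeries.X * kerPoly' (PowerSeries.C a) v)
    (hs0 : constantCoeff s = 1) (hr0 : constantCoeff r = 1)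
    (hs : (1 - z) ^ 2 * s ^ 2 = discPoly z (PowerSeries.C a))
    (hr : (1 - z) ^ 2 * r ^ 2 = discPoly z v) :
    (PowerSeries.C a - v ^ 2) * diagFactor z (PowerSeries.C a) * z * (1 + v) =
      PowerSeries.C a * sqrtFactor z v * r * s := by
  have h1 : (1 - z) ≠ 0 := one_sub_ne_zero (by rw [hz']; simp)
  have hsq := diagFactor_sq_eq hz hv
  obtain ⟨v', hv'⟩ := hv0
  set A := PowerSeries.C a with hA
  rw [← sub_eq_zero]
  have hmul : ((A - v ^ 2) * diagFactor z A * z * (1 + v) - A * sqrtFactor z v * r * s) *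
      ((A - v ^ 2) * diagFactor z A * z * (1 + v) + A * sqrtFactor z v * r * s) = 0 := by
    refine (mul_eq_zero.1 ?_).resolve_left (pow_ne_zero 4 h1)
    linear_combination hsq - A ^ 2 * sqrtFactor z v ^ 2 * ((1 - z) ^ 2 * r ^ 2 * hs
      + discPoly z A * hr)
  refine (mul_eq_zero.1 hmul).resolve_right fun h0 => ?_
  have e : PowerSeries.X * ((A - v ^ 2) * diagFactor z A * z' * (1 + v)
      + A * (z' * (1 - z) + 2 * v' * z - (1 - z) * (v' * v)) * r * s) =
      PowerSeries.X * 0 := by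
    rw [mul_zero, ← h0]
    simp only [sqrtFactor]
    linear_combination (- (A - v ^ 2) * diagFactor z A * (1 + v) - A * (1 - z) * r * s) * hz'
      - A * r * s * (2 * z - (1 - z) * v) * hv'
  have e' := congrArg PowerSeries.constantCoeff (mul_left_cancel₀ PowerSeries.X_ne_zero e)
  have cv : constantCoeff v = 0 := by simp [hv']
  have cz : constantCoeff z = 0 := by simp [hz']
  simp only [diagFactor, map_sub, map_mul, map_add, map_one, map_pow, map_ofNat, hA,
    PowerSeries.constantCoeff_C, cv, cz, hs0, hr0, hz1, map_zero] at e'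
  have : a * 2 = 0 := by linear_combination e'
  simp [ha] at this

/-- Putting y = tw makes the kernel equation a fixed-point equation for w, with constant term
(1+a)/a. -/
theorem exists_kernel_root {a : K} (ha : a ≠ 0) : ∃ y y' : PowerSeries K,
    y = PowerSeries.X * y' ∧ a * constantCoeff y' = 1 + a ∧
      PowerSeries.C a * y = PowerSeries.X * kerPoly (PowerSeries.C a) y := by
  have hc : PowerSeries.C a * PowerSeries.C a⁻¹ = (1 : PowerSeries K) := by
    rw [← map_mul, mul_inv_cancel₀ ha, map_one]
  obtain ⟨w, hw, -⟩ := existsUnique_fixedPoint (R := K)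
    (fun w => PowerSeries.C a⁻¹ * kerPoly (PowerSeries.C a) (PowerSeries.X * w))
    (fun f g => ⟨PowerSeries.C a⁻¹ * (PowerSeries.C a ^ 2 + 1
      + (PowerSeries.C a + PowerSeries.C a ^ 2) * PowerSeries.X * (f + g)), by
        simp only [kerPoly]; ring⟩)
  beta_reduce at hw
  have hw' : PowerSeries.C a * w = kerPoly (PowerSeries.C a) (PowerSeries.X * w) := by
    linear_combination -PowerSeries.C a * hw
      + kerPoly (PowerSeries.C a) (PowerSeries.X * w) * hc
  refine ⟨PowerSeries.X * w, w, rfl, ?_, ?_⟩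
  · have := congrArg PowerSeries.constantCoeff hw'
    simp only [kerPoly, map_mul, map_add, map_pow, map_one, PowerSeries.constantCoeff_C,
      PowerSeries.constantCoeff_X] at this
    linear_combination this
  · linear_combination PowerSeries.X * hw'

end Invariants

/-! ### The field ℚ(x) and the vanishing of antisymmetric series. -/

section Specializations

theorem constS_rat (f : PowerSeries ℚ) : constS ℚ f = f := by
  simp [constS]

theorem evX_zero_Qx0 : evX (0 : PowerSeries ℚ) Qx0 = Q00 := by
  have := evX_C_eq_map (evalRingHom (0 : ℚ)) Qx0
  rwa [coe_evalRingHom, eval_X, map_zero] at this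

/-- The field `ℚ(x)`. -/
abbrev RatX : Type := FractionRing ℚ[X]

/-- The variable of `ℚ(x)`. -/
def ratX : RatX := algebraMap ℚ[X] RatX X

/-- The variable of `ℚ(x)`, as a constant power series. -/
abbrev serRatX : PowerSeries RatX := PowerSeries.C ratX

theorem ratX_ne_zero : ratX ≠ 0 := by
  rw [ratX, map_ne_zero_iff _ (IsFractionRing.injective ℚ[X] RatX)]
  exact X_ne_zero

theorem one_add_ratX_ne_zero : 1 + ratX ≠ 0 := by
  rw [ratX, ← map_one (algebraMap ℚ[X] RatX), ← map_add,
    map_ne_zero_iff _ (IsFractionRing.injective ℚ[X] RatX)]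
  intro h
  have := congrArg (eval 0) h
  simp at this

theorem evX_serRatX (f : PowerSeries ℚ[X]) :
    evX serRatX f = PowerSeries.map (algebraMap ℚ[X] RatX) f :=
  evX_C_eq_map (algebraMap ℚ[X] RatX) f

theorem evX_serRatX_injective : Function.Injective (evX serRatX) := by
  intro f g h
  rw [evX_serRatX, evX_serRatX] at h
  exact PowerSeries.map_injective _ (IsFractionRing.injective ℚ[X] RatX) h

/-- Let c(x) be the lowest nonzero coefficient of `W` in t. As y has no constant term, the relation
becomes c(x) + (1+x)c(0) = 0. At x = 0 this gives c(0) = 0, and then c = 0. Polynomial coefficients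
in x are essential, since c is evaluated at 0. -/
theorem eq_zero_of_antisymmetric {W : PowerSeries ℚ[X]} {y : PowerSeries RatX}
    (hy : PowerSeries.constantCoeff y = 0)
    (hW : (1 + y) * evX serRatX W + (1 + serRatX) * evX y W = 0) : W = 0 := by
  by_contra hne
  obtain ⟨n, g, rfl, hg⟩ := exists_eq_X_pow_mul hne
  apply hg
  have e : PowerSeries.X ^ n * ((1 + y) * evX serRatX g + (1 + serRatX) * evX y g) =
      PowerSeries.X ^ n * 0 := by
    rw [mul_zero, ← hW]
    simp only [map_mul, map_pow, evX_X]
    ring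
  have e' := congrArg PowerSeries.constantCoeff
    (mul_left_cancel₀ (pow_ne_zero n PowerSeries.X_ne_zero) e)
  simp only [map_add, map_mul, map_one, map_zero, hy, PowerSeries.constantCoeff_C, evX_serRatX,
    constantCoeff_evX, add_zero, one_mul] at e'
  set c := PowerSeries.constantCoeff g
  have h1 : PowerSeries.constantCoeff (PowerSeries.map (algebraMap ℚ[X] RatX) g) =
      algebraMap ℚ[X] RatX c := by
    rw [← PowerSeries.coeff_zero_eq_constantCoeff_apply, PowerSeries.coeff_map,
      PowerSeries.coeff_zero_eq_constantCoeff_apply]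
  have h2 : c.eval₂ (algebraMap ℚ RatX) 0 = algebraMap ℚ[X] RatX (C (c.coeff 0)) := by
    rw [eval₂_at_zero]
    exact DFunLike.congr_fun
      (Subsingleton.elim (algebraMap ℚ RatX) ((algebraMap ℚ[X] RatX).comp C)) _
  rw [h1, h2, ratX, ← map_one (algebraMap ℚ[X] RatX), ← map_add, ← map_mul, ← map_add,
    map_eq_zero_iff _ (IsFractionRing.injective ℚ[X] RatX)] at e'
  have h3 := congrArg (eval 0) e'
  simp only [eval_add, eval_mul, eval_one, eval_X, eval_C, eval_zero, ← coeff_zero_eq_eval_zero]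
    at h3
  have h4 : c.coeff 0 = 0 := by linarith
  rw [h4, C_0, mul_zero, add_zero] at e'
  exact e'

end Specializations

/-! ### Solving the kernel equation for Q(x,0). -/

section Solution

variable {Z : PowerSeries ℚ} {R : PowerSeries ℚ[X]}

/-- Since Δ₊(0) = 1, the root is ±1 at x = 0, and its constant term in t selects the sign. The
factor x found here permits the division by x in `defect`. -/
theorem exists_sqrt_eq_one_add (hZ : PowerSeries.constantCoeff Z = 0)
    (hR1 : PowerSeries.constantCoeff R = 1)
    (hR : (1 - constX Z) ^ 2 * R ^ 2 = discPoly (constX Z) serX) : ∃ R', R = 1 + serX * R' := by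
  have h1 : 1 - Z ≠ 0 := one_sub_ne_zero hZ
  have h2 := congrArg (evX (0 : PowerSeries ℚ)) hR
  rw [map_discPoly] at h2
  simp only [map_mul, map_pow, map_sub, map_one, evX_constX, constS_rat, evX_serX] at h2
  have h3 : evX (0 : PowerSeries ℚ) R ^ 2 = 1 := by
    refine mul_left_cancel₀ (pow_ne_zero 2 h1) (h2.trans ?_)
    simp only [discPoly]
    ring
  have h4 : evX (0 : PowerSeries ℚ) R = 1 := by
    rcases sq_eq_sq_iff_eq_or_eq_neg.1 (h3.trans (one_pow 2).symm) with h | h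
    · exact h
    · have := congrArg PowerSeries.constantCoeff h
      rw [constantCoeff_evX, hR1] at this
      norm_num at this
  obtain ⟨g, hg⟩ := exists_eq_serX_mul (f := R - 1) (by rw [map_sub, h4, map_one, sub_self])
  exact ⟨g, by linear_combination hg⟩

theorem kernel_equation {S : Type*} [CommRing S] [Algebra ℚ S] {x y : PowerSeries S}
    (h : x * y = PowerSeries.X * kerPoly x y) :
    PowerSeries.X * (1 + x) * evX x Qx0 + PowerSeries.X * (1 + y) * evX y Qx0
      - PowerSeries.X * constS S Q00 = x * y := by
  have := congrArg (evXY x y) functional_equation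
  simp only [map_mul, map_pow, map_sub, map_add, map_one, evXY_varx, evXY_vary, evXY_X, evXY_inX,
    evXY_inY, evXY_inT] at this
  simp only [kerPoly] at h
  linear_combination this - evXY x y Q * h

theorem lower_kernel_equation {S : Type*} [CommRing S] [Algebra ℚ S] {x v : PowerSeries S}
    (h : x * v = PowerSeries.X * kerPoly' x v) :
    x * v + PowerSeries.X * v * constS S Q00
        + (v * (x - PowerSeries.X * (x ^ 2 + 1)) - 2 * PowerSeries.X * x * (1 + x)) * evX x Qd
        - 2 * PowerSeries.X * v * (1 + v) * evX v Qx0 = 0 := by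
  have := congrArg (evXY x v) lower_functional_equation
  simp only [map_mul, map_pow, map_sub, map_add, map_one, evXY_varx, evXY_vary, evXY_X, evXY_inX,
    evXY_inY, evXY_inT, map_ofNat] at this
  simp only [kerPoly'] at h
  linear_combination 2 * evXY x v lowerQ * h - this

/-- In `S⟦t⟧`, the series `Z` is `t` times a series with constant term `1`, and it satisfies its
defining equation. -/
theorem exists_constS_eq {S : Type*} [CommRing S] [Algebra ℚ S] (hZ : IsZ Z) :
    (∃ w, constS S Z = PowerSeries.X * w ∧ PowerSeries.constantCoeff w = 1) ∧
      constS S Z * (1 - constS S Z) ^ 2 = PowerSeries.X * zPoly (constS S Z) := by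
  rw [isZ_iff] at hZ
  have h := congrArg (constS S) hZ.2
  have hX : constS S PowerSeries.X = PowerSeries.X := by simp [constS]
  rw [map_mul, map_mul, hX, map_zPoly, map_pow, map_sub, map_one] at h
  refine ⟨?_, h⟩
  obtain ⟨w, hw⟩ := PowerSeries.X_dvd_iff.2 hZ.1
  have hw' : constS S Z = PowerSeries.X * constS S w := by rw [hw, map_mul, hX]
  refine ⟨constS S w, hw', ?_⟩
  -- `S` need not be a domain, so cancelling t is checked on coefficients.
  have hcan : Function.Injective fun f : PowerSeries S => PowerSeries.X * f := by
    intro f g hfg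
    ext n
    have := congrArg (PowerSeries.coeff (n + 1)) hfg
    simpa [PowerSeries.coeff_succ_X_mul] using this
  have h2 : constS S w * (1 - constS S Z) ^ 2 = zPoly (constS S Z) := by
    apply hcan
    beta_reduce
    linear_combination h - (1 - constS S Z) ^ 2 * hw'
  have h3 := congrArg PowerSeries.constantCoeff h2
  have h4 : PowerSeries.constantCoeff (constS S Z) = 0 := by rw [hw']; simp
  simp only [zPoly, map_mul, map_pow, map_sub, map_add, map_one, h4, map_ofNat] at h3
  simpa using h3

theorem evX_disc {S : Type*} [CommRing S] [Algebra ℚ S]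
    (hR : (1 - constX Z) ^ 2 * R ^ 2 = discPoly (constX Z) serX) (a : PowerSeries S) :
    (1 - constS S Z) ^ 2 * evX a R ^ 2 = discPoly (constS S Z) a := by
  have := congrArg (evX a) hR
  rw [map_discPoly] at this
  simpa only [map_mul, map_pow, map_sub, map_one, evX_constX, evX_serX] using this

theorem constantCoeff_evX_eq_one {S : Type*} [CommRing S] [Algebra ℚ S]
    (hR1 : PowerSeries.constantCoeff R = 1) (a : PowerSeries S) :
    PowerSeries.constantCoeff (evX a R) = 1 := by
  rw [constantCoeff_evX, hR1, eval₂_one]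

/-- This combines the decoupling 2xy = F(x) + F(y) with the antisymmetry of the square-root term.
The products x s' and y r' replace s - 1 and r - 1, so the terms with poles at x = 0 and y = 0 have
cancelled. -/
theorem defect_identity {A : Type*} [CommRing A] {t x y z q a b s r s' r' : A}
    (hanti : y * (1 + y) * sqrtFactor z x * s + x * (1 + x) * sqrtFactor z y * r = 0)
    (hker : x * y = t * kerPoly x y) (hz : z * (1 - z) ^ 2 = t * zPoly z)
    (heq : t * (1 + x) * a + t * (1 + y) * b - t * q = x * y)
    (hs : s = 1 + x * s') (hr : r = 1 + y * r') :
    x * y * ((1 + y) * (z * (1 - z) ^ 2 * (1 + x) * (2 * (t * (1 + x) * a) - t * q) - zPoly z * x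
        + z * (1 - z) ^ 2 * (2 + x ^ 2)
        - (1 - z) * ((2 * z - (1 - z) * x) * s + z * (1 - z) * s'))
      + (1 + x) * (z * (1 - z) ^ 2 * (1 + y) * (2 * (t * (1 + y) * b) - t * q) - zPoly z * y
        + z * (1 - z) ^ 2 * (2 + y ^ 2)
        - (1 - z) * ((2 * z - (1 - z) * y) * r + z * (1 - z) * r'))) = 0 := by
  generalize zPoly z = p at *
  simp only [kerPoly] at hker
  simp only [sqrtFactor] at hanti
  linear_combination 2 * z * (1 - z) ^ 2 * (1 + x) * (1 + y) * x * y * heq - (1 - z) * hanti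
    + z * (1 - z) ^ 2 * (y * (1 + y) * hs + x * (1 + x) * hr)
    - p * (x + y + 2 * x * y) * hker
    + (2 * (x * y) ^ 2 * (1 + x) * (1 + y) + y * (1 + y) * (1 + 2 * x + x ^ 3)
      + x * (1 + x) * (1 + 2 * y + y ^ 3)) * hz

/-- The quotient by `x` of the difference of both sides in the formula for `Q(x,0;t)`. -/
def defect (z R R' T : PowerSeries ℚ[X]) : PowerSeries ℚ[X] :=
  z * (1 - z) ^ 2 * (1 + serX) * (2 * (PowerSeries.X * (1 + serX) * Qx0) - T)
    - zPoly z * serX + z * (1 - z) ^ 2 * (2 + serX ^ 2)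
    - (1 - z) * ((2 * z - (1 - z) * serX) * R + z * (1 - z) * R')

theorem defect_eq_zero (hZ : IsZ Z) (hR1 : PowerSeries.constantCoeff R = 1)
    (hR : (1 - constX Z) ^ 2 * R ^ 2 = discPoly (constX Z) serX) {R' : PowerSeries ℚ[X]}
    (hR' : R = 1 + serX * R') :
    defect (constX Z) R R' (PowerSeries.X * constX Q00) = 0 := by
  obtain ⟨y, y', hy, hy1, hker⟩ := exists_kernel_root ratX_ne_zero
  have hy0 : PowerSeries.constantCoeff y = 0 := by simp [hy]
  obtain ⟨⟨w, hw, hw1⟩, hz⟩ := exists_constS_eq (S := RatX) hZ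
  have hanti := sqrtFactor_antiinvariant hw hw1 ratX_ne_zero one_add_ratX_ne_zero hy hy1 hz hker
    (constantCoeff_evX_eq_one hR1 serRatX) (constantCoeff_evX_eq_one hR1 y)
    (evX_disc hR serRatX) (evX_disc hR y)
  have heq := kernel_equation hker
  refine eq_zero_of_antisymmetric hy0 ?_
  -- At y = 0 the kernel polynomial reduces to 1 + x, which is not zero.
  have hyne : y ≠ 0 := by
    rintro rfl
    have h := mul_left_cancel₀ PowerSeries.X_ne_zero
      ((show PowerSeries.X * 0 = PowerSeries.X * kerPoly serRatX 0 by rw [← hker]; ring))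
    have h' := congrArg PowerSeries.constantCoeff h
    simp only [kerPoly, map_mul, map_add, map_pow, map_one, map_zero,
      PowerSeries.constantCoeff_C] at h'
    exact one_add_ratX_ne_zero (by linear_combination -h')
  have hxne : serRatX ≠ 0 := by
    rw [Ne, map_eq_zero_iff _ PowerSeries.C_injective]
    exact ratX_ne_zero
  refine (mul_eq_zero.1 (?_ : (serRatX * y) * _ = 0)).resolve_left (mul_ne_zero hxne hyne)
  have r1 := congrArg (evX serRatX) hR'
  have r2 := congrArg (evX y) hR'
  simp only [map_add, map_mul, map_one, evX_serX] at r1 r2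
  simp only [defect, map_zPoly, map_mul, map_pow, map_sub, map_add, map_one, evX_constX, evX_serX,
    evX_X, map_ofNat]
  exact defect_identity hanti hker hz heq r1 r2

end Solution

/-! ### The three formulas without denominators. -/

section Formulas

variable {Z : PowerSeries ℚ} {R : PowerSeries ℚ[X]}

theorem IsZ.ne_zero (hZ : IsZ Z) : Z ≠ 0 := by
  rintro rfl
  have := ((isZ_iff 0).1 hZ).2
  rw [zero_mul, zPoly] at this
  refine PowerSeries.X_ne_zero (R := ℚ) ?_
  linear_combination -this

theorem powerSeries_two_ne_zero {A : Type*} [CommRing A] [CharZero A] :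
    (2 : PowerSeries A) ≠ 0 := by
  intro h
  have := congrArg PowerSeries.constantCoeff h
  simp [map_ofNat] at this

theorem serX_ne_zero : (serX : PowerSeries ℚ[X]) ≠ 0 := by
  rw [Ne, map_eq_zero_iff _ PowerSeries.C_injective]
  exact X_ne_zero

theorem one_add_serX_ne_zero : (1 + serX : PowerSeries ℚ[X]) ≠ 0 := by
  rw [← map_one PowerSeries.C, ← map_add, Ne, map_eq_zero_iff _ PowerSeries.C_injective]
  intro h
  have := congrArg (eval 0) h
  simp at this

theorem Q00_formula (hZ : IsZ Z) (hR1 : PowerSeries.constantCoeff R = 1)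
    (hR : (1 - constX Z) ^ 2 * R ^ 2 = discPoly (constX Z) serX) :
    PowerSeries.X * (1 - Z) ^ 2 * Q00 = Z * (1 - 2 * Z - Z ^ 2) := by
  have hZ' := (isZ_iff Z).1 hZ
  obtain ⟨R', hR'⟩ := exists_sqrt_eq_one_add hZ'.1 hR1 hR
  have hZ0 := hZ.ne_zero
  have h1 := congrArg (evX (0 : PowerSeries ℚ)) (defect_eq_zero hZ hR1 hR hR')
  simp only [defect, map_zPoly, map_mul, map_pow, map_sub, map_add, map_one, evX_constX, evX_serX,
    evX_X, map_ofNat, constS_rat, evX_zero_Qx0, map_zero] at h1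
  -- The equation of the root divided by x; its value at x = 0 determines R'(0), the one unknown
  -- besides Q(0,0) in the defect there.
  have h2 : (1 - constX Z) ^ 2 * (2 * R' + serX * R' ^ 2) =
      (1 - constX Z) ^ 2 * constX Z ^ 2 * serX - 2 * constX Z * (1 + constX Z ^ 2) := by
    refine mul_left_cancel₀ serX_ne_zero ?_
    rw [hR', discPoly] at hR
    linear_combination hR
  have h3 := congrArg (evX (0 : PowerSeries ℚ)) h2
  have h4 := congrArg (evX (0 : PowerSeries ℚ)) hR'
  simp only [map_mul, map_pow, map_sub, map_add, map_one, evX_constX, evX_serX,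
    map_ofNat, constS_rat] at h3 h4
  refine mul_left_cancel₀ (mul_ne_zero powerSeries_two_ne_zero hZ0) ?_
  linear_combination 2 * h1 + 4 * (1 - Z) * Z * h4 + Z * h3

theorem Qx0_formula (hZ : IsZ Z) (hR1 : PowerSeries.constantCoeff R = 1)
    (hR : (1 - constX Z) ^ 2 * R ^ 2 = discPoly (constX Z) serX) :
    constX Z * (1 - constX Z) ^ 2 * (1 + serX) * serX * (2 * (PowerSeries.X * (1 + serX) * Qx0)
        - PowerSeries.X * constX Q00) =
      zPoly (constX Z) * serX ^ 2
        - constX Z * (1 - constX Z) ^ 2 * (1 + 2 * serX + serX ^ 3)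
        + (1 - constX Z) * sqrtFactor (constX Z) serX * R := by
  obtain ⟨R', hR'⟩ := exists_sqrt_eq_one_add ((isZ_iff Z).1 hZ).1 hR1 hR
  have h := defect_eq_zero hZ hR1 hR hR'
  rw [defect] at h
  rw [sqrtFactor]
  linear_combination serX * h - constX Z * (1 - constX Z) ^ 2 * hR'

/-- The kernel relation turns the coefficient of d in `hlow` into t(1+x)(v² - x). This is the factor
that `hd` also produces, so it can be cancelled and leaves an equation free of v. -/
theorem diag_identity {A : Type*} [CommRing A] {t x v z q s r b d : A}
    (hz : z * (1 - z) ^ 2 = t * zPoly z) (hv : x * v = t * kerPoly' x v)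
    (hd : (x - v ^ 2) * diagFactor z x * z * (1 + v) = x * sqrtFactor z v * r * s)
    (hlow : x * v + t * v * q + (v * (x - t * (x ^ 2 + 1)) - 2 * t * x * (1 + x)) * d
      - 2 * t * v * (1 + v) * b = 0)
    (hb : z * (1 - z) ^ 2 * (1 + v) * v * (2 * (t * (1 + v) * b) - t * q) =
      zPoly z * v ^ 2 - z * (1 - z) ^ 2 * (1 + 2 * v + v ^ 3) + (1 - z) * sqrtFactor z v * r) :
    z * (1 - z) ^ 2 * (1 + v) * (v ^ 2 - x) *
      (t * x * (1 + x) * (1 - z) * s * d + diagFactor z x - (1 - z) * s) = 0 := by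
  generalize zPoly z = p at *
  generalize diagFactor z x = e at *
  generalize sqrtFactor z v = f at *
  simp only [kerPoly'] at hv
  linear_combination x * (1 - z) * s * (z * (1 - z) ^ 2 * (1 + v)) * (hlow - d * hv)
    + x * (1 - z) * s * hb - (1 - z) ^ 2 * hd + (1 - z) * s * p * v * hv
    - (1 - z) * s * v * (x * v ^ 2 + v ^ 2 + x ^ 2 * v + v + x + x ^ 2) * hz

theorem Qd_formula (hZ : IsZ Z) (hR1 : PowerSeries.constantCoeff R = 1)
    (hR : (1 - constX Z) ^ 2 * R ^ 2 = discPoly (constX Z) serX) :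
    PowerSeries.X * serX * (1 + serX) * (1 - constX Z) * R * Qd + diagFactor (constX Z) serX
      - (1 - constX Z) * R = 0 := by
  obtain ⟨y, y', hy, -, hker⟩ := exists_kernel_root ratX_ne_zero
  obtain ⟨⟨w, hw, hw1⟩, hz⟩ := exists_constS_eq (S := RatX) hZ
  -- The polynomial `kerPoly'` at (x, xy) is x times `kerPoly` at (x, y), so the same root serves
  -- both kernels.
  set v := serRatX * y with hvdef
  have hv : serRatX * v = PowerSeries.X * kerPoly' serRatX v := by
    rw [hvdef, kerPoly']
    rw [kerPoly] at hker
    linear_combination serRatX * hker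
  have hv0 : PowerSeries.X ∣ v := by
    rw [hvdef, hy]
    exact Dvd.intro_left (serRatX * y' : PowerSeries RatX) (by ring)
  have hd := diagFactor_eq hw hw1 ratX_ne_zero hv0 hz hv
    (constantCoeff_evX_eq_one hR1 serRatX) (constantCoeff_evX_eq_one hR1 v)
    (evX_disc hR serRatX) (evX_disc hR v)
  have hlow := lower_kernel_equation hv
  have hb := congrArg (evX v) (Qx0_formula hZ hR1 hR)
  simp only [map_zPoly, map_sqrtFactor, map_mul, map_pow, map_sub, map_add, map_one, evX_constX,
    evX_serX, evX_X, map_ofNat] at hb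
  have hcz : PowerSeries.constantCoeff (constS RatX Z) = 0 := by rw [hw]; simp
  have hcv : PowerSeries.constantCoeff v = 0 := PowerSeries.X_dvd_iff.1 hv0
  have hne : constS RatX Z * (1 - constS RatX Z) ^ 2 * (1 + v) * (v ^ 2 - serRatX) ≠ 0 := by
    refine mul_ne_zero (mul_ne_zero (mul_ne_zero ?_ (pow_ne_zero 2 (one_sub_ne_zero hcz))) ?_) ?_
    · rw [hw]
      refine mul_ne_zero PowerSeries.X_ne_zero ?_
      rintro rfl
      simp at hw1
    · intro h
      have := congrArg PowerSeries.constantCoeff h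
      simp [hcv] at this
    · intro h
      have := congrArg PowerSeries.constantCoeff h
      simp [hcv, ratX_ne_zero] at this
  have := (mul_eq_zero.1 (diag_identity hz hv hd hlow hb)).resolve_left hne
  apply evX_serRatX_injective
  simp only [map_diagFactor, map_mul, map_sub, map_add, map_one, evX_constX,
    evX_serX, evX_X, map_zero]
  exact this

end Formulas

/-! ### Algebraicity of Z, of the specializations and of Q(x,y;t). -/

section Algebraicity

variable {Z : PowerSeries ℚ} {R : PowerSeries ℚ[X]}

variable {A S : Type*} [CommRing A] [IsDomain A] [CommRing S] [Algebra A S]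

theorem isAlgebraic_of_isZ_equation {t : A} (ht : t ≠ 0) (h2 : (4 : A) ≠ 0) {z : S}
    (hz : z * (1 - z) ^ 2 = algebraMap A S t * zPoly z) : IsAlgebraic A z := by
  refine ⟨X * (1 - X) ^ 2 - C t * zPoly X, ?_, ?_⟩
  · intro h
    -- At 1 the polynomial takes the value -4t, hence it is not zero.
    have h1 := congrArg (eval 1) h
    simp only [zPoly, eval_sub, eval_add, eval_mul, eval_pow, eval_one, eval_X, eval_C, eval_zero,
      eval_ofNat] at h1
    have h3 : 4 * t = 0 := by linear_combination -h1
    exact mul_ne_zero h2 ht h3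
  · have := map_zPoly (aeval z : A[X] →ₐ[A] S).toRingHom X
    simp only [AlgHom.toRingHom_eq_coe, RingHom.coe_coe, aeval_X] at this
    rw [map_sub, map_mul, map_mul, this, map_pow, map_sub, map_one, aeval_X, aeval_C, hz, sub_self]

theorem IsAlgebraic.of_mul_eq [IsDomain S] {m n f : S} (hm0 : m ≠ 0) (hm : IsAlgebraic A m)
    (hn : IsAlgebraic A n) (h : m * f = n) : IsAlgebraic A f :=
  IsAlgebraic.of_mul (mem_nonZeroDivisors_of_ne_zero hm0) hm (h ▸ hn)

variable (A S) in
/-- The inclusion in `S` of the ring of its elements that are algebraic over `A`. -/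
def algVal : Subalgebra.algebraicClosure A S →+* S := algebraMap _ _

theorem isAlgebraic_algVal (a : Subalgebra.algebraicClosure A S) : IsAlgebraic A (algVal A S a) :=
  (Subalgebra.mem_algebraicClosure A S).1 a.2

theorem exists_algVal_eq {f : S} (hf : IsAlgebraic A f) : ∃ a, algVal A S a = f :=
  ⟨⟨f, (Subalgebra.mem_algebraicClosure A S).2 hf⟩, rfl⟩

theorem isAlgebraic_map_sqrt [IsDomain S] (hZ : IsZ Z)
    (hR : (1 - constX Z) ^ 2 * R ^ 2 = discPoly (constX Z) serX)
    (φ : PowerSeries ℚ[X] →+* S) (hφ : Function.Injective φ)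
    (hx : IsAlgebraic A (φ serX)) (hz : IsAlgebraic A (φ (constX Z))) :
    IsAlgebraic A (φ R) := by
  have hZ0 : PowerSeries.constantCoeff (constX Z) = 0 := by
    rw [constantCoeff_constX, ((isZ_iff Z).1 hZ).1, C_0]
  obtain ⟨z', hz'⟩ := exists_algVal_eq hz
  obtain ⟨x', hx'⟩ := exists_algVal_eq hx
  refine IsAlgebraic.of_pow two_pos ?_
  refine IsAlgebraic.of_mul_eq (m := φ ((1 - constX Z) ^ 2)) (n := φ (discPoly (constX Z) serX))
    ((map_ne_zero_iff φ hφ).2 (pow_ne_zero 2 (one_sub_ne_zero hZ0))) ?_ ?_ ?_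
  · have := isAlgebraic_algVal ((1 - z') ^ 2)
    rwa [map_pow, map_sub, map_one, hz', ← map_one φ, ← map_sub, ← map_pow] at this
  · have := isAlgebraic_algVal (discPoly z' x')
    rwa [map_discPoly, hz', hx', ← map_discPoly] at this
  · rw [← hR, map_mul, map_pow φ R]

theorem isAlgebraic_map_Q00 [IsDomain S] (hZ : IsZ Z) (hR1 : PowerSeries.constantCoeff R = 1)
    (hR : (1 - constX Z) ^ 2 * R ^ 2 = discPoly (constX Z) serX)
    (φ : PowerSeries ℚ →+* S) (hφ : Function.Injective φ)
    (ht : IsAlgebraic A (φ PowerSeries.X)) (hz : IsAlgebraic A (φ Z)) :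
    IsAlgebraic A (φ Q00) := by
  obtain ⟨z', hz'⟩ := exists_algVal_eq hz
  obtain ⟨t', ht'⟩ := exists_algVal_eq ht
  refine IsAlgebraic.of_mul_eq (m := φ (PowerSeries.X * (1 - Z) ^ 2))
    (n := φ (Z * (1 - 2 * Z - Z ^ 2))) ((map_ne_zero_iff φ hφ).2 (mul_ne_zero PowerSeries.X_ne_zero
      (pow_ne_zero 2 (one_sub_ne_zero ((isZ_iff Z).1 hZ).1)))) ?_ ?_ ?_
  · have := isAlgebraic_algVal (t' * (1 - z') ^ 2)
    simpa only [map_mul, map_pow, map_sub, map_one, hz', ht'] using this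
  · have := isAlgebraic_algVal (z' * (1 - 2 * z' - z' ^ 2))
    simpa only [map_mul, map_pow, map_sub, map_one, map_ofNat, hz'] using this
  · rw [← map_mul φ, Q00_formula hZ hR1 hR]

/-- The embedding `φ` is left general because the result is needed for both Q(x,0) and Q(y,0),
through `inX` and `inY`. -/
theorem isAlgebraic_map_Qx0 [IsDomain S] (hZ : IsZ Z) (hR1 : PowerSeries.constantCoeff R = 1)
    (hR : (1 - constX Z) ^ 2 * R ^ 2 = discPoly (constX Z) serX)
    (φ : PowerSeries ℚ[X] →+* S) (hφ : Function.Injective φ)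
    (ht : IsAlgebraic A (φ PowerSeries.X)) (hx : IsAlgebraic A (φ serX))
    (hz : IsAlgebraic A (φ (constX Z))) : IsAlgebraic A (φ Qx0) := by
  have hZ0 : PowerSeries.constantCoeff (constX Z) = 0 := by
    rw [constantCoeff_constX, ((isZ_iff Z).1 hZ).1, C_0]
  have hcX : constX PowerSeries.X = PowerSeries.X := by simp
  have hq : IsAlgebraic A (φ (constX Q00)) :=
    isAlgebraic_map_Q00 hZ hR1 hR (φ.comp constX) (hφ.comp constX_injective)
      (by rwa [RingHom.comp_apply, hcX]) hz
  obtain ⟨s', hs'⟩ := exists_algVal_eq (isAlgebraic_map_sqrt hZ hR φ hφ hx hz)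
  obtain ⟨q', hq'⟩ := exists_algVal_eq hq
  obtain ⟨z', hz'⟩ := exists_algVal_eq hz
  obtain ⟨x', hx'⟩ := exists_algVal_eq hx
  obtain ⟨t', ht'⟩ := exists_algVal_eq ht
  have hz0 : constX Z ≠ 0 := (map_ne_zero_iff _ constX_injective).2 hZ.ne_zero
  refine IsAlgebraic.of_mul_eq
    (m := φ (2 * PowerSeries.X * serX * constX Z * (1 - constX Z) ^ 2 * (1 + serX) ^ 2))
    (n := φ (constX Z * (1 - constX Z) ^ 2 * (1 + serX) * serX * (PowerSeries.X * constX Q00)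
      + zPoly (constX Z) * serX ^ 2
      - constX Z * (1 - constX Z) ^ 2 * (1 + 2 * serX + serX ^ 3)
      + (1 - constX Z) * sqrtFactor (constX Z) serX * R)) ?_ ?_ ?_ ?_
  · rw [map_ne_zero_iff φ hφ]
    exact mul_ne_zero (mul_ne_zero (mul_ne_zero (mul_ne_zero (mul_ne_zero powerSeries_two_ne_zero
      PowerSeries.X_ne_zero) serX_ne_zero) hz0) (pow_ne_zero 2 (one_sub_ne_zero hZ0)))
      (pow_ne_zero 2 one_add_serX_ne_zero)
  · have := isAlgebraic_algVal (2 * t' * x' * z' * (1 - z') ^ 2 * (1 + x') ^ 2)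
    simpa only [map_mul, map_pow, map_sub, map_add, map_one, map_ofNat, hz', ht', hx'] using this
  · have := isAlgebraic_algVal (z' * (1 - z') ^ 2 * (1 + x') * x' * (t' * q') + zPoly z' * x' ^ 2
      - z' * (1 - z') ^ 2 * (1 + 2 * x' + x' ^ 3) + (1 - z') * sqrtFactor z' x' * s')
    simpa only [map_mul, map_pow, map_sub, map_add, map_one, map_ofNat, map_zPoly, map_sqrtFactor,
      hz', ht', hx', hq', hs'] using this
  · rw [← map_mul φ]
    refine congrArg φ ?_
    linear_combination Qx0_formula hZ hR1 hR

theorem isAlgebraic_of_functional_equation [IsDomain S] {x y t a b q f : S}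
    (hx : IsAlgebraic A x) (hy : IsAlgebraic A y) (ht : IsAlgebraic A t) (ha : IsAlgebraic A a)
    (hb : IsAlgebraic A b) (hq : IsAlgebraic A q)
    (hne : x * y - t * (x ^ 2 * y + y + x * y ^ 2 + x + x ^ 2 * y ^ 2 + 1) ≠ 0)
    (h : (x * y - t * (x ^ 2 * y + y + x * y ^ 2 + x + x ^ 2 * y ^ 2 + 1)) * f =
      x * y - t * (1 + x) * a - t * (1 + y) * b + t * q) : IsAlgebraic A f := by
  obtain ⟨a', rfl⟩ := exists_algVal_eq ha
  obtain ⟨b', rfl⟩ := exists_algVal_eq hb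
  obtain ⟨q', rfl⟩ := exists_algVal_eq hq
  obtain ⟨x', rfl⟩ := exists_algVal_eq hx
  obtain ⟨y', rfl⟩ := exists_algVal_eq hy
  obtain ⟨t', rfl⟩ := exists_algVal_eq ht
  refine IsAlgebraic.of_mul_eq hne ?_ ?_ h
  · have := isAlgebraic_algVal (x' * y' - t' * (x' ^ 2 * y' + y' + x' * y' ^ 2 + x'
      + x' ^ 2 * y' ^ 2 + 1))
    simpa only [map_mul, map_pow, map_sub, map_add, map_one] using this
  · have := isAlgebraic_algVal (x' * y' - t' * (1 + x') * a' - t' * (1 + y') * b' + t' * q')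
    simpa only [map_mul, map_pow, map_sub, map_add, map_one] using this

theorem isAlgebraic_Q : IsAlgebraic ℚ[X][X][X] Q := by
  obtain ⟨Z, hZ, -⟩ := existsUnique_isZ
  obtain ⟨R, hR, -⟩ := existsUnique_isSqrtDeltaPlus ((isZ_iff Z).1 hZ).1
  obtain ⟨hR1, hR⟩ := (isSqrtDeltaPlus_iff ((isZ_iff Z).1 hZ).1 R).1 hR
  have hmap : ∀ p : ℚ[X][X][X], algebraMap ℚ[X][X][X] (PowerSeries ℚ[X][X]) p = p := fun p => by
    rw [Algebra.algebraMap_eq_smul_one, smul_eq_coe_mul, mul_one]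
  have ht : IsAlgebraic ℚ[X][X][X] vart := by
    have := isAlgebraic_algebraMap (R := ℚ[X][X][X]) (A := PowerSeries ℚ[X][X]) X
    rwa [hmap, coe_X] at this
  have hC : ∀ p : ℚ[X][X], IsAlgebraic ℚ[X][X][X] (PowerSeries.C p) := fun p => by
    have := isAlgebraic_algebraMap (R := ℚ[X][X][X]) (A := PowerSeries ℚ[X][X]) (C p)
    rwa [hmap, coe_C] at this
  have hinTX : inT PowerSeries.X = PowerSeries.X := by simp [inT]
  have hz : IsAlgebraic ℚ[X][X][X] (inT Z) := by
    refine isAlgebraic_of_isZ_equation (t := X) X_ne_zero (by norm_num) ?_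
    have := congrArg inT ((isZ_iff Z).1 hZ).2
    rwa [map_mul, map_mul, map_zPoly, map_pow, map_sub, map_one, hinTX, ← coe_X, ← hmap] at this
  have hinX : Function.Injective inX := PowerSeries.map_injective _ C_injective
  have hinY : Function.Injective inY :=
    PowerSeries.map_injective _ (map_injective _ C_injective)
  have hXZ : ∀ f, inX (constX f) = inT f := fun f => by ext; simp [inX, inT]
  have hYZ : ∀ f, inY (constX f) = inT f := fun f => by ext; simp [inY, inT]
  have hA := isAlgebraic_map_Qx0 (A := ℚ[X][X][X]) hZ hR1 hR inX hinX (by simpa [inX] using ht)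
    (by simpa [inX] using hC (C X)) (by rwa [hXZ])
  have hB := isAlgebraic_map_Qx0 (A := ℚ[X][X][X]) hZ hR1 hR inY hinY (by simpa [inY] using ht)
    (by simpa [inY] using hC X) (by rwa [hYZ])
  have hq := isAlgebraic_map_Q00 (A := ℚ[X][X][X]) hZ hR1 hR inT
    (PowerSeries.map_injective _ (C_injective.comp C_injective)) (by rwa [hinTX]) hz
  have hx : IsAlgebraic ℚ[X][X][X] varx := hC _
  have hy : IsAlgebraic ℚ[X][X][X] vary := hC _
  refine isAlgebraic_of_functional_equation hx hy ht hA hB hq ?_ functional_equation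
  -- At t = 0 the kernel is xy, so it is not zero.
  intro h
  have := congrArg PowerSeries.constantCoeff h
  simp at this

end Algebraicity

end QuadrantWalks

end

/-! ### The theorem in the field of fractions. -/

open QuadrantWalks
theorem mainTheorem9 :
    (∃! Z : PowerSeries ℚ, IsZ Z) ∧
    (∀ (Z₀ : PowerSeries ℚ) (Z : F), IsZ Z₀ → Z = constToF Z₀ →
      constToF Q00 = Z * (1 - 2 * Z - Z ^ 2) / (t * (1 - Z) ^ 2) ∧
      (∃! R : PowerSeries (Polynomial ℚ), IsSqrtDeltaPlus Z R) ∧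
      (∀ (R : PowerSeries (Polynomial ℚ)) (s : F), IsSqrtDeltaPlus Z R → s = toF R →
        toF Qx0 =
          (Z * (1 - Z) + 2 * x * Z - (1 - Z) * x ^ 2) * s
              / (2 * t * x * Z * (1 - Z) * (1 + x) ^ 2)
            - (Z * (1 - Z) ^ 2 + Z * (Z ^ 3 + 4 * Z ^ 2 - 5 * Z + 2) * x
                - (1 - 2 * Z + 7 * Z ^ 2 - 4 * Z ^ 3) * x ^ 2 + x ^ 3 * Z * (1 - Z) ^ 2)
              / (2 * t * x * Z * (1 - Z) ^ 2 * (1 + x) ^ 2) ∧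
        toF Qd =
          (1 - Z - 2 * x * Z + x ^ 2 * Z * (Z - 1)) / (t * x * (1 + x) * (Z - 1) * s)
            + 1 / (t * x * (1 + x)))) ∧
    IsAlgebraic (Polynomial (Polynomial (Polynomial ℚ))) Q := by
  refine ⟨existsUnique_isZ, ?_, isAlgebraic_Q⟩
  rintro Z₀ Z hZ rfl
  have hZ0 := ((isZ_iff Z₀).1 hZ).1
  have hinj : ∀ {f : PowerSeries (Polynomial ℚ)}, f ≠ 0 → toF f ≠ 0 :=
    fun hf => (map_ne_zero_iff _ toF_injective).2 hf
  have hne_t : t ≠ 0 := hinj PowerSeries.X_ne_zero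
  have hne_two : (2 : F) ≠ 0 := by
    have := hinj powerSeries_two_ne_zero
    rwa [map_ofNat] at this
  have hne_x : x ≠ 0 := hinj serX_ne_zero
  have hne_x1 : 1 + x ≠ 0 := by
    have := hinj one_add_serX_ne_zero
    rwa [map_add, map_one] at this
  have hne_Z : constToF Z₀ ≠ 0 := hinj ((map_ne_zero_iff _ constX_injective).2 hZ.ne_zero)
  have hne_Z1 : 1 - constToF Z₀ ≠ 0 := by
    have := hinj ((map_ne_zero_iff _ constX_injective).2 (one_sub_ne_zero hZ0))
    rwa [map_sub, map_sub, map_one, map_one] at this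
  have hsqrt := existsUnique_isSqrtDeltaPlus hZ0
  have htC : constToF PowerSeries.X = t := by
    rw [constToF_apply, t]
    simp
  have hq : t * (1 - constToF Z₀) ^ 2 * constToF Q00 =
      constToF Z₀ * (1 - 2 * constToF Z₀ - constToF Z₀ ^ 2) := by
    -- No root occurs in the formula for Q(0,0), but its derivation goes through one.
    obtain ⟨R, hR, -⟩ := hsqrt
    obtain ⟨hR1, hR⟩ := (isSqrtDeltaPlus_iff hZ0 R).1 hR
    have := congrArg constToF (Q00_formula hZ hR1 hR)
    simpa only [map_mul, map_pow, map_sub, map_one, map_ofNat, htC] using this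
  refine ⟨?_, hsqrt, ?_⟩
  · rw [eq_div_iff (mul_ne_zero hne_t (pow_ne_zero 2 hne_Z1))]
    linear_combination hq
  rintro R s hR rfl
  obtain ⟨hR1, hR⟩ := (isSqrtDeltaPlus_iff hZ0 R).1 hR
  have h1 := congrArg toF (Qx0_formula hZ hR1 hR)
  have h2 := congrArg toF (Qd_formula hZ hR1 hR)
  have hne_s : toF R ≠ 0 := by
    refine hinj ?_
    rintro rfl
    simp at hR1
  rw [map_zero] at h2
  simp only [map_mul, map_pow, map_sub, map_add, map_one, map_ofNat, map_zPoly, map_sqrtFactor,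
    map_diagFactor, ← constToF_apply] at h1 h2
  change constToF Z₀ * (1 - constToF Z₀) ^ 2 * (1 + x) * x * (2 * (t * (1 + x) * toF Qx0)
    - t * constToF Q00) = zPoly (constToF Z₀) * x ^ 2
      - constToF Z₀ * (1 - constToF Z₀) ^ 2 * (1 + 2 * x + x ^ 3)
      + (1 - constToF Z₀) * sqrtFactor (constToF Z₀) x * toF R at h1
  change t * x * (1 + x) * (1 - constToF Z₀) * toF R * toF Qd + diagFactor (constToF Z₀) x
    - (1 - constToF Z₀) * toF R = 0 at h2
  rw [zPoly, sqrtFactor] at h1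
  rw [diagFactor] at h2
  generalize constToF Z₀ = Z at *
  generalize toF R = s at *
  generalize toF Qx0 = A at *
  generalize toF Qd = B at *
  generalize constToF Q00 = c at *
  have hne_Z1' : Z - 1 ≠ 0 := by
    rw [← neg_sub]
    exact neg_ne_zero.2 hne_Z1
  constructor
  · refine mul_left_cancel₀ (mul_ne_zero (mul_ne_zero (mul_ne_zero (mul_ne_zero (mul_ne_zero hne_two
      hne_t) hne_x) hne_Z) (pow_ne_zero 2 hne_Z1)) (pow_ne_zero 2 hne_x1)) ?_
    -- The numerators are kept as letters so that clearing denominators stays cheap.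
    have e : ∀ a b : F, (2 * t * x * Z * (1 - Z) ^ 2 * (1 + x) ^ 2) *
        (a / (2 * t * x * Z * (1 - Z) * (1 + x) ^ 2)
          - b / (2 * t * x * Z * (1 - Z) ^ 2 * (1 + x) ^ 2)) = (1 - Z) * a - b := by
      intro a b
      field_simp
    rw [e]
    linear_combination h1 + Z * (1 + x) * x * hq
  · refine mul_left_cancel₀ (mul_ne_zero (mul_ne_zero (mul_ne_zero (mul_ne_zero hne_t hne_x) hne_x1)
      hne_Z1') hne_s) ?_
    have e : ∀ a : F, (t * x * (1 + x) * (Z - 1) * s) *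
        (a / (t * x * (1 + x) * (Z - 1) * s) + 1 / (t * x * (1 + x))) = a + (Z - 1) * s := by
      intro a
      field_simp
    rw [e]
    linear_combination -h2
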